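/- Let $M\le N$ and $K$ be positive integers, and let $\rho>0$ be the transmit SNR. A base station with $M$ antennas, using the identity precoder, serves $M$ clusters of $K$ users with $N$ antennas each. The $N\times M$ channel matrices $\mathbf H_{i,j}$ (user $j$ of cluster $i$) are Rayleigh fading: all their entries are independent circularly symmetric complex Gaussian variables of mean $0$ and variance $1$. Let $\mathbf h_{i,j}$ be the $i$-th column of $\mathbf H_{i,j}$, let $\mathbf U_{i,j}$ be an $N\times(N-M+1)$ matrix whose orthonormal columns are left singular vectors, for the singular value $0$, of $\mathbf H_{i,j}$ with its $i$-th column removed (i.e. $\mathbf U_{i,j}^H\mathbf U_{i,j}=\mathbf I$ and $\mathbf U_{i,j}^H$ annihilates all the other columns), and let $\mathbf v_{i,j}=\mathbf U_{i,j}\mathbf z_{i,j}$ with $\mathbf z_{i,j}=\mathbf U_{i,j}^H\mathbf h_{i,j}/|\mathbf U_{i,j}^H\mathbf h_{i,j}|$. In each cluster number the users so that $|\mathbf v_{i,1}^H\mathbf h_{i,1}|^2\ge\cdots\ge|\mathbf v_{i,K}^H\mathbf h_{i,K}|^2$. Let $1\le n<k\le K$, and pair the $n$-th and $k$-th ordered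 users of each cluster for MIMO-NOMA, with fixed power allocation coefficients $\alpha_n,\alpha_k$, the same in all clusters, such that $\alpha_n^2+\alpha_k^2=1$. Put $$SNR_{i,k}=\frac{|\mathbf v_{i,k}^H\mathbf h_{i,k}|^2\alpha_k^2}{|\mathbf v_{i,k}^H\mathbf h_{i,k}|^2\alpha_n^2+|\mathbf v_{i,k}|^2\frac1\rho},\qquad SNR_{i,n}=\rho\,\frac{|\mathbf v_{i,n}^H\mathbf h_{i,n}|^2\alpha_n^2}{|\mathbf v_{i,n}|^2},$$ and define the sum-rate gap between MIMO-NOMA and MIMO-OMA by $$\Delta=\sum_{i=1}^M\left[\log_2(1+SNR_{i,k})+\log_2(1+SNR_{i,n})\right]-\frac12\sum_{i=1}^M\left[\log_2\left(1+\rho|\mathbf v_{i,k}^H\mathbf h_{i,k}|^2\right)+\log_2\left(1+\rho|\mathbf v_{i,n}^H\mathbf h_{i,n}|^2\right)\right].$$ For $1\le m\le K$ and $\phi\ge0$ let $\gamma_m=\frac{K!}{(K-m)!\,(m-1)!}$, $\gamma(a,x)=\int_0^x t^{a-1}e^{-t}\,dt$ and $$\varphi(m,\phi)=\frac{\phi}{\ln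 2}\int_0^\infty\frac1{1+x\phi}\left(1-\sum_{p=0}^{m-1}\binom{m-1}{p}\gamma_m(-1)^p\,\frac{\left[\frac{\gamma(N-M+1,x)}{(N-M)!}\right]^{K-m+p+1}}{K-m+p+1}\right)dx .$$ Then the integrals defining $\varphi$ converge, $\Delta$ is integrable, and the average sum-rate gap is $$\mathcal E\{\Delta\}=\frac M2\varphi(k,\rho)+M\varphi(n,\rho\alpha_n^2)-M\varphi(k,\rho\alpha_n^2)-\frac M2\varphi(n,\rho).$$ -/

import Mathlib

open MeasureTheory ProbabilityTheory
open scoped Matrix NNReal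

namespace MimoNoma

noncomputable section

/-- Euclidean norm `|w|` of a complex vector. -/
def vecNorm {m : ℕ} (w : Fin m → ℂ) : ℝ :=
  ‖WithLp.toLp 2 w‖

/-- Rayleigh fading: `H ω i j` is the `N × M` channel matrix of the `j`-th (not yet ordered) user of
the `i`-th cluster. All entries of all channel matrices are independent and circularly symmetric
complex Gaussian of mean `0` and variance `1`, that is, all real and imaginary parts are independent
real Gaussian variables of mean `0` and variance `1 / 2`. -/
def IsRayleighFading {Ω : Type*} [MeasurableSpace Ω] (μ : Measure Ω) {M N K : ℕ}
    (H : Ω → Fin M → Fin K → Matrix (Fin N) (Fin M) ℂ) : Prop :=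
  (∀ i j a b, HasLaw (fun ω => (H ω i j a b).re) (gaussianReal 0 (1 / 2 : ℝ≥0)) μ) ∧
  (∀ i j a b, HasLaw (fun ω => (H ω i j a b).im) (gaussianReal 0 (1 / 2 : ℝ≥0)) μ) ∧
  iIndepFun
    (fun (q : (Fin M × Fin K × Fin N × Fin M) × Bool) (ω : Ω) =>
      if q.2 then (H ω q.1.1 q.1.2.1 q.1.2.2.1 q.1.2.2.2).re
      else (H ω q.1.1 q.1.2.1 q.1.2.2.1 q.1.2.2.2).im) μ

/-- The columns of `U` are `N - M + 1` orthonormal left singular vectors, for the singular value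
zero, of the matrix obtained from `A` by deleting the `i`-th column. (When that `N × (M - 1)` matrix
has full column rank, they form an orthonormal basis of its whole left null space.) -/
def IsNullSpaceBasis {M N : ℕ} (A : Matrix (Fin N) (Fin M) ℂ) (i : Fin M)
    (U : Matrix (Fin N) (Fin (N - M + 1)) ℂ) : Prop :=
  Uᴴ * U = 1 ∧ ∀ m : Fin M, m ≠ i → Uᴴ *ᵥ A.col m = 0

/-- Detection vector `v = U z` with the maximal ratio combining weights
`z = Uᴴ h / |Uᴴ h|`. -/
def detectionVector {N L : ℕ} (U : Matrix (Fin N) (Fin L) ℂ) (h : Fin N → ℂ) : Fin N → ℂ :=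
  U *ᵥ (((vecNorm (Uᴴ *ᵥ h))⁻¹ : ℝ) • (Uᴴ *ᵥ h))

section Rates

variable {M N K : ℕ} (H : Fin M → Fin K → Matrix (Fin N) (Fin M) ℂ)
  (U : Fin M → Fin K → Matrix (Fin N) (Fin (N - M + 1)) ℂ)

/-- Detection vector of the `j`-th user of cluster `i`; with the identity precoder the channel
vector that carries the signal of cluster `i` is the `i`-th column of the user's channel matrix. -/
def userDetector (i : Fin M) (j : Fin K) : Fin N → ℂ :=
  detectionVector (U i j) ((H i j).col i)

/-- Effective channel gain `|vᴴ h|²` of the `j`-th user of cluster `i`. -/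
def effGain (i : Fin M) (j : Fin K) : ℝ :=
  ‖star (userDetector H U i j) ⬝ᵥ (H i j).col i‖ ^ 2

/-- `σ i r` is the user of cluster `i` that comes at place `r` (counted from `0`) when the users of
the cluster are listed by decreasing effective channel gain. -/
def IsGainOrdering (σ : Fin M → Equiv.Perm (Fin K)) : Prop :=
  ∀ i, Antitone fun r : Fin K => effGain H U i (σ i r)

/-- NOMA: SNR of the paired user with the poorer channel, who treats the signal of the other paired
user as noise; `αn`, `αk` are the power allocation coefficients of the stronger and of the weaker
user, `ρ` is the transmit SNR. -/
def snrWeak (ρ αn αk : ℝ) (i : Fin M) (j : Fin K) : ℝ :=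
  effGain H U i j * αk ^ 2 /
    (effGain H U i j * αn ^ 2 + vecNorm (userDetector H U i j) ^ 2 * (1 / ρ))

/-- NOMA: SNR of the paired user with the better channel, after the signal of the other paired user
has been decoded and removed. -/
def snrStrong (ρ αn : ℝ) (i : Fin M) (j : Fin K) : ℝ :=
  ρ * (effGain H U i j * αn ^ 2 / vecNorm (userDetector H U i j) ^ 2)

/-- Sum-rate gap between MIMO-NOMA and MIMO-OMA (rates in bits per channel use), when in every
cluster the users at the places `n` and `k` of the ordering `σ` are paired. -/
def sumRateGap (σ : Fin M → Equiv.Perm (Fin K)) (ρ αn αk : ℝ) (n k : Fin K) : ℝ :=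
  (∑ i : Fin M,
      (Real.logb 2 (1 + snrWeak H U ρ αn αk i (σ i k)) +
        Real.logb 2 (1 + snrStrong H U ρ αn i (σ i n)))) -
    1 / 2 * ∑ i : Fin M,
      (Real.logb 2 (1 + ρ * effGain H U i (σ i k)) +
        Real.logb 2 (1 + ρ * effGain H U i (σ i n)))

end Rates

/-- Lower incomplete gamma function `γ(a, x) = ∫₀ˣ e⁻ᵗ tᵃ⁻¹ dt`. -/
def lowerGamma (a x : ℝ) : ℝ :=
  ∫ t in (0 : ℝ)..x, Real.exp (-t) * t ^ (a - 1)

/-- `γ_n = K! / ((K - n)! (n - 1)!)`, for `1 ≤ n ≤ K`. -/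
def orderCoeff (K n : ℕ) : ℝ :=
  (K.factorial : ℝ) / ((K - n).factorial * (n - 1).factorial)

/-- Integrand of `varphi`, for `M ≤ N` and `1 ≤ n ≤ K`. -/
def varphiIntegrand (M N K n : ℕ) (ϕ x : ℝ) : ℝ :=
  1 / (1 + x * ϕ) *
    (1 - ∑ p ∈ Finset.range n, ((n - 1).choose p : ℝ) * orderCoeff K n * (-1) ^ p *
      ((lowerGamma ((N - M + 1 : ℕ) : ℝ) x / ((N - M).factorial : ℝ)) ^ (K - n + p + 1) /
        ((K - n + p + 1 : ℕ) : ℝ)))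

/-- `φ(n, ϕ) = (ϕ / ln 2) ∫₀^∞ (1 / (1 + x ϕ)) (1 - ∑ₚ …) dx`, for `M ≤ N` and `1 ≤ n ≤ K`. -/
def varphi (M N K n : ℕ) (ϕ : ℝ) : ℝ :=
  ϕ / Real.log 2 * ∫ x in Set.Ioi (0 : ℝ), varphiIntegrand M N K n ϕ x

end

end MimoNoma

namespace MimoNoma

/-! Write `g` for an effective gain. The detection vector is a unit vector as soon as `g ≠ 0`, and
all rates vanish when `g = 0`. Since `αk ^ 2 = 1 - αn ^ 2`, the rate of the weak user is `log (1 + ρ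
g) - log (1 + ρ αn² g)`, while that of the strong user is `log (1 + ρ αn² g)`
(`logb_one_add_snrWeak`, `snrStrong_eq`). The gap is thus a linear combination of terms `log (1 + φ
g)` with `g` an ordered gain, and it remains to see that `varphi` is the mean of such a term.

The gain equals `|Uᴴ h|²`. Almost surely the interfering columns are linearly independent, so `U Uᴴ`
is the projection on their orthogonal complement and the gain does not depend on the choice of `U`
(`effGain_eq_nullSpaceGain`). With the interfering columns frozen, `Uᴴ h` consists of `N - M + 1`
independent standard complex Gaussians, whose squared length is gamma distributed whatever the
frozen columns are; hence so is the gain (`hasLaw_vecNorm_columnResidual`). The users of a cluster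
are independent, so their gains form an i.i.d. gamma sample.

The `r`-th largest of `K` such gains is at most `x` when fewer than `r` of them exceed `x`. This
gives a binomial sum, which is rewritten as the alternating sum inside `varphi`
(`sum_choose_mul_pow_eq`). The layer cake formula with `log (1 + φ z) = ∫₀ᶻ φ / (1 + x φ) dx` then
turns the mean of the logarithm into `varphi` (`integral_logb_orderStatistic`). -/

/-! ### Two forms of the distribution function of an order statistic -/

/-- Each derivative is a difference of neighbouring Bernstein polynomials of lower degree, so the
sum telescopes. -/
lemma derivative_sum_bernsteinPolynomial (K m : ℕ) :
    Polynomial.derivative (∑ s ∈ Finset.range (m + 1), bernsteinPolynomial ℝ K s) =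
      -(K : Polynomial ℝ) * bernsteinPolynomial ℝ (K - 1) m := by
  induction m with
  | zero => simp [bernsteinPolynomial.derivative_zero]
  | succ m ih =>
    rw [Finset.sum_range_succ, Polynomial.derivative_add, ih, bernsteinPolynomial.derivative_succ]
    ring

lemma orderCoeff_succ {K m : ℕ} (hm : m < K) :
    orderCoeff K (m + 1) = K * (K - 1).choose m := by
  obtain ⟨d, rfl⟩ := Nat.exists_eq_add_of_lt hm
  have h1 : m + d + 1 - (m + 1) = d := by omega
  have h2 : m + d + 1 - 1 = m + d := by omega
  rw [orderCoeff, h1, h2, Nat.add_sub_cancel, Nat.factorial_succ]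
  have h := Nat.add_choose_mul_factorial_mul_factorial m d
  rw [← Nat.choose_symm_add] at h
  have h' : ((m + d).choose m : ℝ) * m.factorial * d.factorial = (m + d).factorial := by
    exact_mod_cast h
  rw [div_eq_iff (by positivity)]
  push_cast
  rw [← h']
  ring

/-- The distribution function of the order statistics of an i.i.d. sample, in its binomial and in
its incomplete beta form. -/
lemma sum_choose_mul_pow_eq (K m : ℕ) (hm : m < K) (x : ℝ) :
    ∑ s ∈ Finset.range (m + 1), (K.choose s : ℝ) * ((1 - x) ^ s * x ^ (K - s)) =
      ∑ p ∈ Finset.range (m + 1), (m.choose p : ℝ) * orderCoeff K (m + 1) * (-1) ^ p *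
        (x ^ (K - (m + 1) + p + 1) / ((K - (m + 1) + p + 1 : ℕ) : ℝ)) := by
  obtain ⟨d, rfl⟩ := Nat.exists_eq_add_of_lt hm
  have hd : m + d + 1 - (m + 1) = d := by omega
  set B : Polynomial ℝ := ∑ s ∈ Finset.range (m + 1), bernsteinPolynomial ℝ (m + d + 1) s with hB
  have hL : ∀ y : ℝ, ∑ s ∈ Finset.range (m + 1),
      ((m + d + 1).choose s : ℝ) * ((1 - y) ^ s * y ^ (m + d + 1 - s)) = B.eval (1 - y) := by
    intro y
    simp [hB, Polynomial.eval_finsetSum, bernsteinPolynomial, mul_assoc]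
  have hdL : ∀ y : ℝ, HasDerivAt (fun y => B.eval (1 - y))
      (orderCoeff (m + d + 1) (m + 1) * ((1 - y) ^ m * y ^ d)) y := by
    intro y
    have h1 := (B.hasDerivAt (1 - y)).comp y ((hasDerivAt_id y).const_sub 1)
    refine h1.congr_deriv ?_
    rw [hB, derivative_sum_bernsteinPolynomial, orderCoeff_succ hm]
    simp [bernsteinPolynomial]
    ring
  have hdR : ∀ y : ℝ, HasDerivAt (fun y => ∑ p ∈ Finset.range (m + 1),
      (m.choose p : ℝ) * orderCoeff (m + d + 1) (m + 1) * (-1) ^ p *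
        (y ^ (d + p + 1) / ((d + p + 1 : ℕ) : ℝ)))
      (orderCoeff (m + d + 1) (m + 1) * ((1 - y) ^ m * y ^ d)) y := by
    intro y
    have h1 : ∀ p ∈ Finset.range (m + 1), HasDerivAt (fun y : ℝ =>
        (m.choose p : ℝ) * orderCoeff (m + d + 1) (m + 1) * (-1) ^ p *
        (y ^ (d + p + 1) / ((d + p + 1 : ℕ) : ℝ)))
        ((m.choose p : ℝ) * orderCoeff (m + d + 1) (m + 1) * (-1) ^ p * y ^ (d + p)) y := by
      intro p _
      have h2 := ((hasDerivAt_pow (d + p + 1) y).div_const ((d + p + 1 : ℕ) : ℝ)).const_mul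
        ((m.choose p : ℝ) * orderCoeff (m + d + 1) (m + 1) * (-1) ^ p)
      refine h2.congr_deriv ?_
      have h3 : ((d + p + 1 : ℕ) : ℝ) ≠ 0 := by positivity
      rw [mul_div_cancel_left₀ _ h3]
      simp
    have h4 := HasDerivAt.fun_sum h1
    refine h4.congr_deriv ?_
    have h5 : (1 - y) ^ m = ∑ p ∈ Finset.range (m + 1), (m.choose p : ℝ) * (-1) ^ p * y ^ p := by
      rw [sub_eq_neg_add, add_pow]
      refine Finset.sum_congr rfl fun p _ => ?_
      rw [neg_pow]
      ring
    rw [h5, Finset.sum_mul, Finset.mul_sum]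
    refine Finset.sum_congr rfl fun p _ => ?_
    ring
  simp only [hd]
  rw [hL]
  -- Both forms have the same derivative, the density of the order statistic, and both vanish at
  -- `0`.
  have hz : ∀ y : ℝ, HasDerivAt (fun y => B.eval (1 - y) - ∑ p ∈ Finset.range (m + 1),
      (m.choose p : ℝ) * orderCoeff (m + d + 1) (m + 1) * (-1) ^ p *
        (y ^ (d + p + 1) / ((d + p + 1 : ℕ) : ℝ))) 0 y := by
    intro y
    exact ((hdL y).fun_sub (hdR y)).congr_deriv (sub_self _)
  have hc := is_const_of_deriv_eq_zero (fun y => (hz y).differentiableAt)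
    (fun y => (hz y).deriv) x 0
  have h0 : B.eval (1 - (0 : ℝ)) = 0 := by
    rw [← hL]
    refine Finset.sum_eq_zero fun s hs => ?_
    have : m + d + 1 - s ≠ 0 := by have := Finset.mem_range.1 hs; omega
    simp [this]
  simp only [h0, sub_eq_iff_eq_add] at hc
  rw [hc]
  simp

/-- The `r`-th largest entry (counted from `0`) is at most `x` iff at most `r` entries exceed `x`. -/
lemma apply_perm_le_iff {K : ℕ} (y : Fin K → ℝ) (σ : Equiv.Perm (Fin K))
    (hσ : Antitone fun r => y (σ r)) (r : Fin K) (x : ℝ) :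
    y (σ r) ≤ x ↔ (Finset.univ.filter fun j => x < y j).card < (r : ℕ) + 1 := by
  have hcard : (Finset.univ.filter fun j => x < y j).card =
      (Finset.univ.filter fun s => x < y (σ s)).card := by
    refine (Finset.card_bij (fun s _ => σ s) ?_ ?_ ?_).symm
    · intro s hs
      simpa using hs
    · intro a _ b _ h
      exact σ.injective h
    · intro j hj
      exact ⟨σ.symm j, by simpa using hj, by simp⟩
  rw [hcard]
  constructor
  · intro h
    have hsub : (Finset.univ.filter fun s => x < y (σ s)) ⊆ Finset.Iio r := by
      intro s hs
      have hs' : x < y (σ s) := by simpa using hs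
      rw [Finset.mem_Iio]
      by_contra hrs
      exact absurd (hσ (not_lt.1 hrs)) (not_le.2 (h.trans_lt hs'))
    have := Finset.card_le_card hsub
    rw [Fin.card_Iio] at this
    omega
  · intro h
    by_contra hx
    have hsub : Finset.Iic r ⊆ (Finset.univ.filter fun s => x < y (σ s)) := by
      intro s hs
      have : y (σ r) ≤ y (σ s) := hσ (Finset.mem_Iic.1 hs)
      simpa using (not_le.1 hx).trans_le this
    have := Finset.card_le_card hsub
    rw [Fin.card_Iic] at this
    omega

/-! ### Law of the order statistics -/

section OrderStatistics

variable {Ω : Type*} [MeasurableSpace Ω] {μ : Measure Ω} {K : ℕ} {G : Fin K → Ω → ℝ}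

/-- Nothing is known about the measurability of `σ`. However, the ordered value does not depend on
which sorting permutation is used, so `Tuple.sort` of the negated sample can replace `σ`; its
sublevel sets are described by counting exceedances. -/
lemma aemeasurable_orderStatistic (hG : ∀ j, AEMeasurable (G j) μ)
    {σ : Ω → Equiv.Perm (Fin K)} (hσ : ∀ᵐ ω ∂μ, Antitone fun r => G (σ ω r) ω) (r : Fin K) :
    AEMeasurable (fun ω => G (σ ω r) ω) μ := by
  have hs : ∀ y : Fin K → ℝ, Antitone fun r => y (Tuple.sort (fun j => -y j) r) := by
    intro y a b hab
    have := Tuple.monotone_sort (fun j => -y j) hab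
    simpa using this
  have hm : Measurable fun y : Fin K → ℝ => y (Tuple.sort (fun j => -y j) r) := by
    refine measurable_of_Iic fun x => ?_
    have : (fun y : Fin K → ℝ => y (Tuple.sort (fun j => -y j) r)) ⁻¹' Set.Iic x =
        {y | (∑ j, if x < y j then 1 else 0 : ℕ) < (r : ℕ) + 1} := by
      ext y
      rw [Set.mem_preimage, Set.mem_Iic, apply_perm_le_iff y _ (hs y), Finset.card_filter]
      rfl
    rw [this]
    refine measurableSet_lt (Finset.measurable_sum _ fun j _ => ?_) measurable_const
    exact Measurable.ite (measurableSet_lt measurable_const (measurable_pi_apply j))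
      measurable_const measurable_const
  refine (hm.comp_aemeasurable (aemeasurable_pi_lambda _ hG)).congr ?_
  filter_upwards [hσ] with ω hω
  have key : ∀ x, G (Tuple.sort (fun j => -G j ω) r) ω ≤ x ↔ G (σ ω r) ω ≤ x := fun x => by
    rw [apply_perm_le_iff (fun j => G j ω) _ (hs fun j => G j ω) r x,
      apply_perm_le_iff (fun j => G j ω) _ hω r x]
  exact le_antisymm ((key _).2 le_rfl) ((key _).1 le_rfl)

/-- The event splits according to the exact set `T` of indices whose value exceeds `x`. Independence
gives the probability of each piece, which depends only on the size of `T`. -/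
lemma measureReal_orderStatistic_le [IsProbabilityMeasure μ] (hG : ∀ j, AEMeasurable (G j) μ)
    (hind : iIndepFun G μ) {x F : ℝ} (hF : ∀ j, μ.real {ω | G j ω ≤ x} = F)
    {σ : Ω → Equiv.Perm (Fin K)} (hσ : ∀ᵐ ω ∂μ, Antitone fun r => G (σ ω r) ω) (r : Fin K) :
    μ.real {ω | G (σ ω r) ω ≤ x} =
      ∑ s ∈ Finset.range ((r : ℕ) + 1), (K.choose s : ℝ) * ((1 - F) ^ s * F ^ (K - s)) := by
  classical
  set E : Finset (Fin K) → Set Ω := fun T => {ω | (Finset.univ.filter fun j => x < G j ω) = T}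
    with hE
  have hEi : ∀ T, E T = ⋂ j ∈ (Finset.univ : Finset (Fin K)),
      G j ⁻¹' (if j ∈ T then Set.Ioi x else Set.Iic x) := by
    intro T
    ext ω
    simp only [hE, Set.mem_ofPred_eq, Finset.ext_iff, Finset.mem_filter, Finset.mem_univ, true_and,
      Set.mem_iInter, Set.mem_preimage, forall_const]
    refine forall_congr' fun j => ?_
    by_cases hj : j ∈ T <;> simp [hj]
  have hEm : ∀ T, NullMeasurableSet (E T) μ := by
    intro T
    rw [hEi]
    refine NullMeasurableSet.biInter (Set.to_countable _) fun j _ => ?_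
    refine (hG j).nullMeasurable ?_
    split_ifs
    exacts [measurableSet_Ioi, measurableSet_Iic]
  have hEr : ∀ T, μ.real (E T) = (1 - F) ^ T.card * F ^ (K - T.card) := by
    intro T
    have h1 : ∀ j, (μ (G j ⁻¹' (if j ∈ T then Set.Ioi x else Set.Iic x))).toReal =
        if j ∈ T then 1 - F else F := by
      intro j
      split_ifs with hj
      · have h2 : G j ⁻¹' Set.Ioi x = {ω | G j ω ≤ x}ᶜ := by
          ext ω
          simp
        have h3 : NullMeasurableSet {ω | G j ω ≤ x} μ := (hG j).nullMeasurable measurableSet_Iic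
        rw [h2, ← measureReal_def, measureReal_compl₀ h3, hF j, probReal_univ]
      · exact hF j
    rw [measureReal_def, hEi, hind.measure_inter_preimage_eq_mul _ (fun j _ => by
      split_ifs
      exacts [measurableSet_Ioi, measurableSet_Iic]), ENNReal.toReal_prod,
      Finset.prod_congr rfl fun j _ => h1 j, Finset.prod_ite]
    have h4 : (Finset.univ.filter fun j => j ∈ T) = T := by simp
    have h5 : (Finset.univ.filter fun j => j ∉ T) = Tᶜ := by ext; simp
    rw [h4, h5, Finset.prod_const, Finset.prod_const, Finset.card_compl, Fintype.card_fin]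
  have hset : {ω | G (σ ω r) ω ≤ x} =ᵐ[μ]
      ⋃ T ∈ (Finset.univ.filter fun T : Finset (Fin K) => T.card < (r : ℕ) + 1), E T := by
    filter_upwards [hσ] with ω hω
    apply propext
    have := apply_perm_le_iff (fun j => G j ω) (σ ω) hω r x
    change G (σ ω r) ω ≤ x ↔ ω ∈ ⋃ T ∈ _, E T
    simp only [Set.mem_iUnion, hE, Set.mem_ofPred_eq, exists_prop, Finset.mem_filter,
      Finset.mem_univ, true_and]
    rw [this]
    exact ⟨fun h => ⟨_, h, rfl⟩, fun ⟨T, h, hT⟩ => hT ▸ h⟩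
  rw [measureReal_congr hset, measureReal_biUnion_finset₀ ?_ fun T _ => hEm T]
  · rw [Finset.sum_congr rfl fun T _ => hEr T, Finset.sum_filter]
    have h6 := Finset.sum_powerset_apply_card (fun s => if s < (r : ℕ) + 1 then
      (1 - F) ^ s * F ^ (K - s) else 0) (x := (Finset.univ : Finset (Fin K)))
    rw [Finset.powerset_univ] at h6
    rw [h6, Finset.card_univ, Fintype.card_fin]
    simp only [nsmul_eq_mul, mul_ite, mul_zero]
    rw [← Finset.sum_filter]
    refine Finset.sum_congr ?_ fun _ _ => rfl
    ext s
    simp only [Finset.mem_filter, Finset.mem_range]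
    omega
  · intro T _ T' _ hTT'
    refine Disjoint.aedisjoint (Set.disjoint_left.2 fun ω h h' => hTT' ?_)
    exact h.symm.trans h'

end OrderStatistics

/-! ### Mean of a logarithm as an integral over tails -/

lemma intervalIntegrable_div_one_add_mul {φ z : ℝ} (hφ : 0 ≤ φ) (hz : 0 ≤ z) :
    IntervalIntegrable (fun x => φ / (1 + x * φ)) volume 0 z := by
  refine ContinuousOn.intervalIntegrable (ContinuousOn.div (by fun_prop) (by fun_prop) fun x hx => ?_)
  rw [Set.uIcc_of_le hz] at hx
  have := mul_nonneg hx.1 hφ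
  positivity

lemma integral_div_one_add_mul {φ z : ℝ} (hφ : 0 ≤ φ) (hz : 0 ≤ z) :
    ∫ x in (0 : ℝ)..z, φ / (1 + x * φ) = Real.log (1 + φ * z) := by
  have h : ∀ x ∈ Set.uIcc 0 z, HasDerivAt (fun x => Real.log (1 + x * φ)) (φ / (1 + x * φ)) x := by
    intro x hx
    rw [Set.uIcc_of_le hz] at hx
    have h0 : 0 < 1 + x * φ := by have := mul_nonneg hx.1 hφ; linarith
    have := (((hasDerivAt_id x).mul_const φ).const_add 1).log h0.ne'
    simpa using this
  rw [intervalIntegral.integral_eq_sub_of_hasDerivAt h]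
  · simp [mul_comm]
  · exact intervalIntegrable_div_one_add_mul hφ hz

section LayerCake

variable {Ω : Type*} [MeasurableSpace Ω] {μ : Measure Ω} {Z : Ω → ℝ}

lemma integrable_log_one_add_mul (hZ : 0 ≤ᵐ[μ] Z) (hi : Integrable Z μ) {φ : ℝ} (hφ : 0 ≤ φ) :
    Integrable (fun ω => Real.log (1 + φ * Z ω)) μ := by
  refine (hi.const_mul φ).mono' ?_ ?_
  · exact (Real.measurable_log.comp_aemeasurable
      ((hi.aemeasurable.const_mul φ).const_add 1)).aestronglyMeasurable
  · filter_upwards [hZ] with ω hω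
    have h0 : 0 ≤ φ * Z ω := mul_nonneg hφ hω
    rw [Real.norm_of_nonneg (Real.log_nonneg (by linarith))]
    have := Real.log_le_sub_one_of_pos (show 0 < 1 + φ * Z ω by linarith)
    linarith

lemma integrableOn_measureReal_lt [IsProbabilityMeasure μ] (hZ : 0 ≤ᵐ[μ] Z)
    (hi : Integrable Z μ) : IntegrableOn (fun x => μ.real {ω | x < Z ω}) (Set.Ioi 0) := by
  have hanti : Antitone fun x => μ.real {ω | x < Z ω} := fun a b hab =>
    measureReal_mono fun ω (h : b < Z ω) => hab.trans_lt h
  refine ⟨hanti.measurable.aestronglyMeasurable, ?_⟩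
  rw [hasFiniteIntegral_iff_ofReal (Filter.Eventually.of_forall fun x => measureReal_nonneg)]
  rw [lintegral_congr fun x => ofReal_measureReal, ← lintegral_eq_lintegral_meas_lt μ hZ hi.aemeasurable]
  exact hi.lintegral_lt_top

lemma integrableOn_tail_div [IsProbabilityMeasure μ] (hZ : 0 ≤ᵐ[μ] Z)
    (hi : Integrable Z μ) {φ : ℝ} (hφ : 0 ≤ φ) :
    IntegrableOn (fun x => 1 / (1 + x * φ) * μ.real {ω | x < Z ω}) (Set.Ioi 0) := by
  refine (integrableOn_measureReal_lt hZ hi).mono' ?_ ?_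
  · refine AEStronglyMeasurable.mul ?_ (integrableOn_measureReal_lt hZ hi).aestronglyMeasurable
    exact Measurable.aestronglyMeasurable (by fun_prop)
  · filter_upwards [ae_restrict_mem measurableSet_Ioi] with x hx
    have h0 : 0 ≤ x * φ := mul_nonneg (le_of_lt hx) hφ
    rw [Real.norm_of_nonneg (by positivity)]
    refine mul_le_of_le_one_left measureReal_nonneg ?_
    rw [div_le_one (by linarith)]
    linarith

/-- The layer cake formula for the primitive `log (1 + φ z)` of `φ / (1 + x φ)`, carried out with
lower integrals and then transferred to Bochner integrals. -/
lemma integral_log_one_add_mul [IsProbabilityMeasure μ] (hZ : 0 ≤ᵐ[μ] Z)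
    (hi : Integrable Z μ) {φ : ℝ} (hφ : 0 ≤ φ) :
    ∫ ω, Real.log (1 + φ * Z ω) ∂μ =
      φ * ∫ x in Set.Ioi (0 : ℝ), 1 / (1 + x * φ) * μ.real {ω | x < Z ω} := by
  have hlc := lintegral_comp_eq_lintegral_meas_lt_mul (g := fun x => φ / (1 + x * φ)) μ hZ
    hi.aemeasurable (fun t ht => intervalIntegrable_div_one_add_mul hφ (le_of_lt ht))
    (by
      filter_upwards [ae_restrict_mem measurableSet_Ioi] with x hx
      have h0 : 0 ≤ x * φ := mul_nonneg (le_of_lt hx) hφ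
      positivity)
  rw [integral_eq_lintegral_of_nonneg_ae ?_ (integrable_log_one_add_mul hZ hi hφ).1,
    ← integral_const_mul, integral_eq_lintegral_of_nonneg_ae ?_
      ((integrableOn_tail_div hZ hi hφ).1.const_mul φ)]
  · congr 1
    have hl : ∫⁻ ω, ENNReal.ofReal (Real.log (1 + φ * Z ω)) ∂μ =
        ∫⁻ ω, ENNReal.ofReal (∫ x in (0 : ℝ)..Z ω, φ / (1 + x * φ)) ∂μ := by
      refine lintegral_congr_ae ?_
      filter_upwards [hZ] with ω hω
      rw [integral_div_one_add_mul hφ hω]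
    rw [hl, hlc]
    refine lintegral_congr_ae ?_
    filter_upwards [ae_restrict_mem measurableSet_Ioi] with x hx
    rw [← ofReal_measureReal (measure_ne_top _ _), ← ENNReal.ofReal_mul measureReal_nonneg]
    congr 1
    ring
  · filter_upwards [ae_restrict_mem measurableSet_Ioi] with x hx
    have h0 : 0 ≤ x * φ := mul_nonneg (le_of_lt hx) hφ
    have := measureReal_nonneg (μ := μ) (s := {ω | x < Z ω})
    simp only [Pi.zero_apply]
    positivity
  · filter_upwards [hZ] with ω hω
    have h0 : 0 ≤ φ * Z ω := mul_nonneg hφ hω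
    exact Real.log_nonneg (by linarith)

end LayerCake

/-! ### Gamma law and sums of squared Gaussians -/

section GammaLaw

lemma integrableOn_pow_mul_cexp_neg (n : ℕ) {c : ℂ} (hc : 0 < c.re) :
    IntegrableOn (fun x : ℝ => (x : ℂ) ^ n * Complex.exp (-(c * x))) (Set.Ioi 0) := by
  have h := integrableOn_rpow_mul_exp_neg_mul_rpow (p := 1) (s := n) (b := c.re)
    (by have : (0 : ℝ) ≤ n := by positivity
        linarith) one_pos hc
  refine h.mono' (Continuous.aestronglyMeasurable (by fun_prop)) ?_
  filter_upwards [ae_restrict_mem measurableSet_Ioi] with x hx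
  rw [norm_mul, norm_pow, Complex.norm_exp, Complex.norm_real,
    Real.norm_of_nonneg (le_of_lt hx), Real.rpow_natCast, Real.rpow_one]
  simp

/-- Integration by parts, as the vanishing integral of a derivative, gives the recursion in `n`. The
complex rate is needed because the gamma characteristic function is the case `c = 1 - t I`. -/
lemma integral_pow_mul_cexp_neg (n : ℕ) {c : ℂ} (hc : 0 < c.re) :
    ∫ x in Set.Ioi (0 : ℝ), (x : ℂ) ^ n * Complex.exp (-(c * x)) = n.factorial / c ^ (n + 1) := by
  have hc0 : c ≠ 0 := fun h => by simp [h] at hc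
  have hder : ∀ (m : ℕ) (x : ℝ), HasDerivAt (fun x : ℝ => (x : ℂ) ^ m * Complex.exp (-(c * x)))
      (m * (x : ℂ) ^ (m - 1) * Complex.exp (-(c * x)) -
        c * ((x : ℂ) ^ m * Complex.exp (-(c * x)))) x := by
    intro m x
    have h1 : HasDerivAt (fun z : ℂ => z ^ m * Complex.exp (-(c * z)))
        (m * (x : ℂ) ^ (m - 1) * Complex.exp (-(c * x)) +
          (x : ℂ) ^ m * (Complex.exp (-(c * x)) * (-(c * 1)))) (x : ℂ) :=
      (hasDerivAt_pow m (x : ℂ)).mul (((hasDerivAt_id (x : ℂ)).const_mul c).fun_neg.cexp)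
    refine h1.comp_ofReal.congr_deriv ?_
    ring
  have hlim : ∀ m : ℕ, Filter.Tendsto (fun x : ℝ => (x : ℂ) ^ m * Complex.exp (-(c * x)))
      Filter.atTop (nhds 0) := by
    intro m
    rw [tendsto_zero_iff_norm_tendsto_zero]
    have h := (isLittleO_pow_exp_pos_mul_atTop (k := m) hc).tendsto_div_nhds_zero
    refine h.congr' ?_
    filter_upwards [Filter.eventually_gt_atTop 0] with x hx
    rw [norm_mul, norm_pow, Complex.norm_exp, Complex.norm_real, Real.norm_of_nonneg hx.le,
      div_eq_mul_inv, ← Real.exp_neg]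
    simp
  induction n with
  | zero =>
    have h := integral_Ioi_of_hasDerivAt_of_tendsto' (a := (0 : ℝ)) (fun x _ => hder 0 x) (by
      simpa [IntegrableOn] using ((integrableOn_pow_mul_cexp_neg 0 hc).const_mul c).neg) (hlim 0)
    simp only [Nat.cast_zero, zero_mul, zero_sub, pow_zero, one_mul] at h
    rw [integral_neg, integral_const_mul] at h
    simp only [pow_zero, one_mul, zero_add, pow_one, Nat.factorial_zero, Nat.cast_one]
    rw [eq_div_iff hc0]
    simp at h
    rw [mul_comm]
    exact h
  | succ n ih =>
    have hi := (integrableOn_pow_mul_cexp_neg n hc).const_mul ((n + 1 : ℕ) : ℂ)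
    have hi' := (integrableOn_pow_mul_cexp_neg (n + 1) hc).const_mul c
    have h := integral_Ioi_of_hasDerivAt_of_tendsto' (a := (0 : ℝ)) (fun x _ => hder (n + 1) x) (by
      refine (hi.sub hi').congr (Filter.Eventually.of_forall fun x => ?_)
      simp [mul_assoc]) (hlim (n + 1))
    simp only [Nat.add_sub_cancel, mul_assoc] at h
    rw [integral_sub hi hi', integral_const_mul, integral_const_mul, ih] at h
    simp at h
    rw [sub_eq_zero] at h
    rw [eq_div_iff (pow_ne_zero _ hc0), pow_succ, mul_comm _ c, ← mul_assoc, mul_comm _ c, ← h,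
      Nat.factorial_succ]
    field_simp
    push_cast
    ring

lemma gammaPDFReal_natCast (n : ℕ) (x : ℝ) :
    gammaPDFReal ((n + 1 : ℕ) : ℝ) 1 x =
      (Set.Ici (0 : ℝ)).indicator (fun x => x ^ n * Real.exp (-x) / n.factorial) x := by
  rw [gammaPDFReal, Set.indicator_apply]
  refine if_congr Iff.rfl ?_ rfl
  push_cast
  rw [Real.Gamma_nat_eq_factorial, Real.one_rpow, add_sub_cancel_right, Real.rpow_natCast, one_mul]
  ring

lemma integral_gammaMeasure {E : Type*} [NormedAddCommGroup E] [NormedSpace ℝ E] (n : ℕ)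
    (f : ℝ → E) :
    ∫ x, f x ∂gammaMeasure ((n + 1 : ℕ) : ℝ) 1 =
      ∫ x in Set.Ioi (0 : ℝ), (x ^ n * Real.exp (-x) / n.factorial) • f x := by
  rw [gammaMeasure, integral_withDensity_eq_integral_toReal_smul
    (f := gammaPDF ((n + 1 : ℕ) : ℝ) 1)
    ((measurable_gammaPDFReal _ _).ennreal_ofReal) (by simp [gammaPDF]),
    ← integral_Ici_eq_integral_Ioi, ← integral_indicator measurableSet_Ici]
  refine integral_congr_ae (Filter.Eventually.of_forall fun x => ?_)
  simp only
  rw [gammaPDF, ENNReal.toReal_ofReal (gammaPDFReal_nonneg (by positivity) one_pos x),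
    gammaPDFReal_natCast]
  by_cases hx : x ∈ Set.Ici (0 : ℝ) <;> simp [hx]

lemma charFun_gammaMeasure (n : ℕ) (t : ℝ) :
    charFun (gammaMeasure ((n + 1 : ℕ) : ℝ) 1) t = ((1 - t * Complex.I)⁻¹) ^ (n + 1) := by
  have hc : 0 < (1 - t * Complex.I).re := by simp
  rw [charFun_apply_real, integral_gammaMeasure]
  have h : ∀ x : ℝ, (x ^ n * Real.exp (-x) / n.factorial) • Complex.exp (t * x * Complex.I) =
      (n.factorial : ℂ)⁻¹ * ((x : ℂ) ^ n * Complex.exp (-((1 - t * Complex.I) * x))) := by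
    intro x
    rw [Complex.real_smul]
    push_cast
    have : Complex.exp (-((1 - t * Complex.I) * x)) =
        Complex.exp (-x) * Complex.exp (t * x * Complex.I) := by
      rw [← Complex.exp_add]
      ring_nf
    rw [this]
    ring
  simp_rw [h]
  rw [integral_const_mul, integral_pow_mul_cexp_neg n hc]
  have : (n.factorial : ℂ) ≠ 0 := by exact_mod_cast n.factorial_ne_zero
  rw [inv_pow]
  field_simp

/-- The Gaussian integral produces a complex square root. Squaring removes it, and suffices because
real and imaginary parts come in pairs. -/
lemma charFun_gaussianReal_map_sq_sq (t : ℝ) :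
    charFun ((gaussianReal 0 (1 / 2 : ℝ≥0)).map fun x => x ^ 2) t ^ 2 =
      (1 - t * Complex.I)⁻¹ := by
  have hc : 0 < (1 - t * Complex.I).re := by simp
  rw [charFun_apply_real, integral_map (by fun_prop) (by fun_prop),
    integral_gaussianReal_eq_integral_smul (by norm_num)]
  have h : ∀ x : ℝ, gaussianPDFReal 0 (1 / 2 : ℝ≥0) x •
      Complex.exp (t * ((x ^ 2 : ℝ) : ℂ) * Complex.I) =
      (((√Real.pi)⁻¹ : ℝ) : ℂ) * Complex.exp (-(1 - t * Complex.I) * x ^ 2) := by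
    intro x
    rw [Complex.real_smul, gaussianPDFReal]
    have h1 : 2 * Real.pi * ((1 / 2 : ℝ≥0) : ℝ) = Real.pi := by
      push_cast
      ring
    have h2 : -(x - 0) ^ 2 / (2 * ((1 / 2 : ℝ≥0) : ℝ)) = -x ^ 2 := by
      push_cast
      ring
    rw [h1, h2]
    push_cast
    rw [mul_assoc, ← Complex.exp_add]
    ring_nf
  simp_rw [h]
  rw [integral_const_mul, integral_gaussian_complex hc, mul_pow, ← Complex.cpow_nat_mul]
  have h3 : (((√Real.pi)⁻¹ : ℝ) : ℂ) ^ 2 = (Real.pi : ℂ)⁻¹ := by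
    rw [← Complex.ofReal_pow, inv_pow, Real.sq_sqrt Real.pi_pos.le]
    simp
  have hpi : (Real.pi : ℂ) ≠ 0 := by exact_mod_cast Real.pi_ne_zero
  rw [h3]
  norm_num
  field_simp

/-- A sum of `2 (n + 1)` squares of independent real Gaussian variables of variance `1 / 2` has the
gamma distribution of shape `n + 1` and rate `1`. -/
lemma hasLaw_sum_sq_gammaMeasure {Ω : Type*} [MeasurableSpace Ω] {μ : Measure Ω}
    [IsProbabilityMeasure μ] (n : ℕ) {Y : Fin (n + 1) × Bool → Ω → ℝ}
    (hY : ∀ q, HasLaw (Y q) (gaussianReal 0 (1 / 2 : ℝ≥0)) μ) (hind : iIndepFun Y μ) :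
    HasLaw (fun ω => ∑ q, Y q ω ^ 2) (gammaMeasure ((n + 1 : ℕ) : ℝ) 1) μ := by
  have hm : ∀ q, AEMeasurable (fun ω => Y q ω ^ 2) μ := fun q => (hY q).aemeasurable.pow_const 2
  have : IsProbabilityMeasure (gammaMeasure ((n + 1 : ℕ) : ℝ) 1) :=
    isProbabilityMeasure_gammaMeasure (by positivity) one_pos
  refine ⟨Finset.aemeasurable_fun_sum _ fun q _ => hm q, ?_⟩
  have := Measure.isProbabilityMeasure_map
    (Finset.aemeasurable_fun_sum Finset.univ fun q _ => hm q)
  refine Measure.ext_of_charFun (funext fun t => ?_)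
  have hsq : iIndepFun (fun q ω => Y q ω ^ 2) μ :=
    hind.comp (fun _ x => x ^ 2) fun _ => measurable_id.pow_const 2
  have hmap : ∀ q, μ.map (fun ω => Y q ω ^ 2) =
      (gaussianReal 0 (1 / 2 : ℝ≥0)).map fun x => x ^ 2 := by
    intro q
    rw [← (hY q).map_eq, AEMeasurable.map_map_of_aemeasurable (by fun_prop) (hY q).aemeasurable]
    rfl
  rw [hsq.charFun_map_fun_sum_eq_prod hm, charFun_gammaMeasure, Finset.prod_apply]
  simp_rw [hmap]
  -- The `(n + 1) * 2` equal factors are grouped in pairs, so that only the squared characteristic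
  -- function enters.
  rw [Finset.prod_const, Finset.card_univ, Fintype.card_prod, Fintype.card_fin, Fintype.card_bool,
    mul_comm, pow_mul, charFun_gaussianReal_map_sq_sq]

lemma measureReal_gammaMeasure_le (n : ℕ) {x : ℝ} (hx : 0 ≤ x) :
    (gammaMeasure ((n + 1 : ℕ) : ℝ) 1).real (Set.Iic x) =
      lowerGamma ((n + 1 : ℕ) : ℝ) x / n.factorial := by
  have : IsProbabilityMeasure (gammaMeasure ((n + 1 : ℕ) : ℝ) 1) :=
    isProbabilityMeasure_gammaMeasure (by positivity) one_pos
  have h1 : Set.Iic x ∩ Set.Ici 0 = Set.Icc 0 x := by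
    ext
    simp [and_comm]
  rw [← cdf_eq_real, cdf_gammaMeasure_eq_integral (by positivity) one_pos, lowerGamma,
    intervalIntegral.integral_of_le hx, ← integral_Icc_eq_integral_Ioc, ← integral_div]
  simp_rw [gammaPDFReal_natCast]
  rw [setIntegral_indicator measurableSet_Ici, h1]
  refine integral_congr_ae (Filter.Eventually.of_forall fun y => ?_)
  push_cast
  rw [add_sub_cancel_right, Real.rpow_natCast, mul_comm]

lemma ae_nonneg_gammaMeasure (a : ℝ) : ∀ᵐ x ∂gammaMeasure a 1, 0 ≤ x := by
  have : gammaMeasure a 1 (Set.Iio 0) = 0 := by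
    rw [gammaMeasure, withDensity_apply _ measurableSet_Iio]
    exact lintegral_gammaPDF_of_nonpos le_rfl
  refine (ae_iff.2 ?_)
  convert this using 2
  ext x
  simp

lemma integrable_id_gammaMeasure (n : ℕ) :
    Integrable (fun x => x) (gammaMeasure ((n + 1 : ℕ) : ℝ) 1) := by
  rw [gammaMeasure, integrable_withDensity_iff_integrable_smul' (f := gammaPDF ((n + 1 : ℕ) : ℝ) 1)
    ((measurable_gammaPDFReal _ _).ennreal_ofReal) (by simp [gammaPDF])]
  -- The extra factor `x` raises the shape of the density from `n + 1` to `n + 2`.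
  have h := (Real.GammaIntegral_convergent (s := (n + 2 : ℕ)) (by positivity)).div_const
    (n.factorial : ℝ)
  replace h := (integrableOn_Ici_iff_integrableOn_Ioi (by simp)).2 h
  rw [← integrable_indicator_iff measurableSet_Ici] at h
  refine h.congr (Filter.Eventually.of_forall fun x => ?_)
  simp only
  rw [gammaPDF, ENNReal.toReal_ofReal (gammaPDFReal_nonneg (by positivity) one_pos x),
    gammaPDFReal_natCast]
  by_cases hx : x ∈ Set.Ici (0 : ℝ)
  · simp only [hx, Set.indicator_of_mem, smul_eq_mul]
    have : ((n + 2 : ℕ) : ℝ) - 1 = ((n + 1 : ℕ) : ℝ) := by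
      push_cast
      ring
    rw [this, Real.rpow_natCast]
    ring
  · simp [hx]

end GammaLaw

/-! ### Rotation invariance of Gaussian vectors -/

section Isotropy

variable {Ω : Type*} [MeasurableSpace Ω] {μ : Measure Ω} [IsProbabilityMeasure μ]

/-- Orthonormal linear combinations of i.i.d. centred Gaussian variables are i.i.d. with the same
law. -/
lemma iIndepFun_and_hasLaw_of_orthonormal {ι κ : Type*} [Fintype ι] [Fintype κ] {v : ℝ≥0}
    {X : ι → Ω → ℝ} (hX : ∀ i, HasLaw (X i) (gaussianReal 0 v) μ) (hind : iIndepFun X μ)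
    (c : κ → ι → ℝ) (hc : ∀ a, ∑ i, c a i * c a i = 1)
    (hc' : ∀ a b, a ≠ b → ∑ i, c a i * c b i = 0) :
    iIndepFun (fun a ω => ∑ i, c a i * X i ω) μ ∧
      ∀ a, HasLaw (fun ω => ∑ i, c a i * X i ω) (gaussianReal 0 v) μ := by
  classical
  have hg : ∀ i, HasGaussianLaw (X i) μ := fun i => (hX i).hasGaussianLaw
  have hL : ∀ i, MemLp (X i) 2 μ := fun i => (hg i).memLp_two
  have hcov : ∀ a b, cov[fun ω => ∑ i, c a i * X i ω, fun ω => ∑ i, c b i * X i ω; μ] =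
      v * ∑ i, c a i * c b i := by
    intro a b
    rw [covariance_fun_sum_fun_sum (fun i => (hL i).const_mul _) (fun i => (hL i).const_mul _)]
    rw [Finset.mul_sum]
    refine Finset.sum_congr rfl fun i _ => ?_
    rw [Finset.sum_eq_single i]
    · rw [covariance_const_mul_left, covariance_const_mul_right,
        covariance_self (hX i).aemeasurable, (hX i).variance_eq]
      simp only [variance_id_gaussianReal]
      ring
    · intro j _ hj
      rw [covariance_const_mul_left, covariance_const_mul_right,
        (hind.indepFun hj.symm).covariance_eq_zero (hL i) (hL j)]
      simp
    · simp
  have hgl : HasGaussianLaw (fun ω a => ∑ i, c a i * X i ω) μ := by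
    have h := (hind.hasGaussianLaw hg).map_fun
      (ContinuousLinearMap.pi fun a => ∑ i, c a i • ContinuousLinearMap.proj i : (ι → ℝ) →L[ℝ] (κ → ℝ))
    refine h.congr (Filter.Eventually.of_forall fun ω => funext fun a => ?_)
    simp
  refine ⟨hgl.iIndepFun_of_covariance_eq_zero fun a b hab => ?_, fun a => ?_⟩
  · rw [hcov, hc' a b hab, mul_zero]
  · have h1 := hgl.eval a
    refine ⟨h1.aemeasurable, ?_⟩
    rw [h1.map_eq_gaussianReal]
    have hmean : ∫ ω, ∑ i, c a i * X i ω ∂μ = 0 := by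
      rw [integral_finsetSum _ fun i _ => ((hL i).integrable (by norm_num)).const_mul _]
      refine Finset.sum_eq_zero fun i _ => ?_
      rw [integral_const_mul, (hX i).integral_eq]
      simp
    have hvar : Var[fun ω => ∑ i, c a i * X i ω; μ] = v := by
      rw [← covariance_self h1.aemeasurable, hcov, hc, mul_one]
    rw [hmean, hvar]
    simp

/-- The projection of a circularly symmetric complex Gaussian vector on `n + 1` orthonormal vectors
has a gamma distributed squared length. -/
lemma hasLaw_norm_sq_conjTranspose_mulVec {N n : ℕ} {Z : Fin N × Bool → Ω → ℝ}
    (hZ : ∀ q, HasLaw (Z q) (gaussianReal 0 (1 / 2 : ℝ≥0)) μ) (hind : iIndepFun Z μ)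
    (U : Matrix (Fin N) (Fin (n + 1)) ℂ) (hU : Uᴴ * U = 1) :
    HasLaw (fun ω => vecNorm (Uᴴ *ᵥ fun a => (Z (a, true) ω + Z (a, false) ω * Complex.I : ℂ)) ^ 2)
      (gammaMeasure ((n + 1 : ℕ) : ℝ) 1) μ := by
  -- The real matrix of `Uᴴ` in terms of real parts (`true`) and imaginary parts (`false`). Its rows
  -- are orthonormal because the columns of `U` are.
  set c : Fin (n + 1) × Bool → Fin N × Bool → ℝ := fun l a =>
    match l.2, a.2 with
    | true, true => (U a.1 l.1).re
    | true, false => (U a.1 l.1).im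
    | false, true => -(U a.1 l.1).im
    | false, false => (U a.1 l.1).re with hcdef
  have hUe : ∀ l m, ∑ a, (starRingEnd ℂ) (U a l) * U a m = if l = m then 1 else 0 := by
    intro l m
    have := congrFun (congrFun hU l) m
    rw [Matrix.mul_apply, Matrix.one_apply] at this
    exact this
  have hre : ∀ l m, ∑ a, ((U a l).re * (U a m).re + (U a l).im * (U a m).im) =
      if l = m then 1 else 0 := by
    intro l m
    have := congrArg Complex.re (hUe l m)
    rw [Complex.re_sum, apply_ite Complex.re] at this
    simpa using this
  have him : ∀ l m, ∑ a, ((U a l).re * (U a m).im - (U a l).im * (U a m).re) = 0 := by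
    intro l m
    have := congrArg Complex.im (hUe l m)
    rw [Complex.im_sum, apply_ite Complex.im] at this
    simpa [sub_eq_add_neg] using this
  have hcsum : ∀ l m, ∑ a, c l a * c m a = if l = m then 1 else 0 := by
    rintro ⟨l, s⟩ ⟨m, t⟩
    rw [Fintype.sum_prod_type]
    simp only [Fintype.sum_bool, hcdef]
    cases s <;> cases t <;> simp only [Prod.mk.injEq, reduceCtorEq, and_false, and_true, if_false]
    · rw [← hre l m]
      exact Finset.sum_congr rfl fun a _ => by ring
    · rw [← him l m]
      exact Finset.sum_congr rfl fun a _ => by ring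
    · rw [← neg_zero, ← him l m, ← Finset.sum_neg_distrib]
      exact Finset.sum_congr rfl fun a _ => by ring
    · rw [← hre l m]
  obtain ⟨h1, h2⟩ := iIndepFun_and_hasLaw_of_orthonormal hZ hind c
    (fun a => by rw [hcsum, if_pos rfl]) (fun a b hab => by rw [hcsum, if_neg hab])
  have h3 := hasLaw_sum_sq_gammaMeasure n h2 h1
  convert h3 using 2 with ω
  rw [vecNorm, EuclideanSpace.norm_sq_eq, Fintype.sum_prod_type]
  refine Finset.sum_congr rfl fun l _ => ?_
  rw [Fintype.sum_bool, Complex.sq_norm, Complex.normSq_apply, ← pow_two, ← pow_two]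
  congr 2
  · simp only [Matrix.mulVec, dotProduct, Complex.re_sum, Fintype.sum_prod_type, Fintype.sum_bool,
      hcdef]
    exact Finset.sum_congr rfl fun a _ => by simp
  · simp only [Matrix.mulVec, dotProduct, Complex.im_sum, Fintype.sum_prod_type, Fintype.sum_bool,
      hcdef]
    exact Finset.sum_congr rfl fun a _ => by simp; ring

end Isotropy

/-! ### Almost sure linear independence of the interfering columns -/

section FullRank

lemma pi_absolutelyContinuous {ι : Type*} [Fintype ι] {X : ι → Type*} [∀ i, MeasurableSpace (X i)]
    {μ ν : ∀ i, Measure (X i)} [∀ i, SigmaFinite (μ i)] [∀ i, SigmaFinite (ν i)]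
    (h : ∀ i, μ i ≪ ν i) : Measure.pi μ ≪ Measure.pi ν := by
  classical
  have : Encodable ι := Fintype.toEncodable ι
  have ht : ∀ l : List ι, Measure.tprod l μ ≪ Measure.tprod l ν := by
    intro l
    induction l with
    | nil => exact Measure.AbsolutelyContinuous.rfl
    | cons i l ih =>
      rw [Measure.tprod_cons, Measure.tprod_cons]
      exact (h i).prod ih
  rw [← Measure.pi'_eq_pi, ← Measure.pi'_eq_pi]
  exact (ht _).map (measurable_tProd_elim' _)

/-- The complex matrix with given real and imaginary parts of its entries. -/
noncomputable def complexMatrix {N : ℕ} {β : Type*} (x : (Fin N × β) × Bool → ℝ) : Matrix (Fin N) β ℂ :=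
  Matrix.of fun a b => (x ((a, b), true) + x ((a, b), false) * Complex.I : ℂ)

/-- The complex vector with given real and imaginary parts of its entries. -/
noncomputable def complexVector {N : ℕ} (x : Fin N × Bool → ℝ) : Fin N → ℂ :=
  fun a => x (a, true) + x (a, false) * Complex.I

@[fun_prop]
lemma continuous_complexMatrix {N : ℕ} {β : Type*} :
    Continuous (complexMatrix : ((Fin N × β) × Bool → ℝ) → Matrix (Fin N) β ℂ) := by
  refine continuous_matrix fun a b => ?_
  simp only [complexMatrix, Matrix.of_apply]
  fun_prop

@[fun_prop]
lemma continuous_complexVector {N : ℕ} :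
    Continuous (complexVector : (Fin N × Bool → ℝ) → Fin N → ℂ) := by
  refine continuous_pi fun a => ?_
  unfold complexVector
  fun_prop

lemma injective_mulVec_of_det_submatrix_ne_zero {N : ℕ} {β : Type*} [Fintype β] [DecidableEq β]
    (A : Matrix (Fin N) β ℂ) (f : β → Fin N) (hA : (A.submatrix f id).det ≠ 0) :
    Function.Injective A.mulVec := by
  have hinj : Function.Injective (A.submatrix f id).mulVec :=
    Matrix.mulVec_injective_iff_isUnit.2 ((Matrix.isUnit_iff_isUnit_det _).2 (isUnit_iff_ne_zero.2 hA))
  intro v w hvw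
  apply hinj
  ext b
  exact congrFun hvw (f b)

/-- Moving by `t` in the direction `e` adds `t` times the identity to the chosen minor. Along each
such line the determinant is a characteristic polynomial in `t`, which has finitely many zeros; a
set that is null on all parallel lines is null. -/
lemma ae_det_submatrix_ne_zero {N : ℕ} {β : Type*} [Fintype β] [DecidableEq β] (f : β ↪ Fin N) :
    ∀ᵐ x : (Fin N × β) × Bool → ℝ, ((complexMatrix x).submatrix f id).det ≠ 0 := by
  set e : (Fin N × β) × Bool → ℝ := fun q => if q.2 = true ∧ f q.1.2 = q.1.1 then 1 else 0 with he
  have hopen : IsOpen {x : (Fin N × β) × Bool → ℝ |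
      ((complexMatrix x).submatrix f id).det ≠ 0} := by
    refine isOpen_ne_fun ?_ continuous_const
    exact (continuous_complexMatrix.matrix_submatrix _ _).matrix_det
  have hmem : ∀ᵐ x : (Fin N × β) × Bool → ℝ, x ∈ {x : (Fin N × β) × Bool → ℝ |
      ((complexMatrix x).submatrix f id).det ≠ 0} := by
    refine ae_mem_of_ae_add_linearMap_mem (LinearMap.toSpanSingleton ℝ _ e) volume volume
      hopen.measurableSet fun y => ?_
    have hadd : ∀ t : ℝ, (complexMatrix (y + LinearMap.toSpanSingleton ℝ _ e t)).submatrix f id =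
        Matrix.scalar β (t : ℂ) - -(complexMatrix y).submatrix f id := by
      intro t
      ext a b
      by_cases hab : a = b
      · subst hab
        simp [complexMatrix, he]
        ring
      · have hab' : ¬ f b = f a := fun h => hab (f.injective h).symm
        simp [complexMatrix, he, hab, hab']
    have hfin : {t : ℝ | (t : ℂ) ∈ (-(complexMatrix y).submatrix f id).charpoly.roots.toFinset}.Finite :=
      Set.Finite.preimage (Complex.ofReal_injective.injOn) (Finset.finite_toSet _)
    have hae := (hfin.measure_zero (volume : Measure ℝ))
    rw [← compl_mem_ae_iff] at hae
    filter_upwards [hae] with t ht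
    rw [hadd, ← Matrix.eval_charpoly]
    intro h0
    refine ht ?_
    simp only [Set.mem_ofPred_eq, Multiset.mem_toFinset]
    exact (Polynomial.mem_roots (Matrix.charpoly_monic _).ne_zero).2 h0
  exact hmem

lemma ae_injective_mulVec {N : ℕ} {β : Type*} [Fintype β] (hβ : Fintype.card β ≤ N) :
    ∀ᵐ x ∂Measure.pi fun _ : (Fin N × β) × Bool => gaussianReal 0 (1 / 2 : ℝ≥0),
      Function.Injective (complexMatrix x).mulVec := by
  classical
  obtain ⟨f⟩ : Nonempty (β ↪ Fin N) := by
    rw [Function.Embedding.nonempty_iff_card_le, Fintype.card_fin]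
    exact hβ
  have hac : (Measure.pi fun _ : (Fin N × β) × Bool => gaussianReal 0 (1 / 2 : ℝ≥0)) ≪ volume :=
    pi_absolutelyContinuous fun _ => gaussianReal_absolutelyContinuous 0 (by norm_num)
  filter_upwards [hac.ae_le (ae_det_submatrix_ne_zero f)] with x hx
  exact injective_mulVec_of_det_submatrix_ne_zero _ f hx

end FullRank

/-! ### The gain as the length of a projection -/

section NullSpace

open scoped ComplexOrder

lemma exists_orthonormal_conjTranspose_mul_eq_zero {N n : ℕ} {β : Type*} [Fintype β]
    (A : Matrix (Fin N) β ℂ) (hcard : Fintype.card β + (n + 1) = N) :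
    ∃ U : Matrix (Fin N) (Fin (n + 1)) ℂ, Uᴴ * U = 1 ∧ Uᴴ * A = 0 := by
  set S : Submodule ℂ (EuclideanSpace ℂ (Fin N)) :=
    Submodule.span ℂ (Set.range fun b => WithLp.toLp 2 fun a => A a b) with hS
  have hfr : n + 1 ≤ Module.finrank ℂ Sᗮ := by
    have h1 := S.finrank_add_finrank_orthogonal
    have h2 : Module.finrank ℂ S ≤ Fintype.card β := finrank_range_le_card _
    rw [finrank_euclideanSpace_fin] at h1
    omega
  set b := stdOrthonormalBasis ℂ Sᗮ
  have hb : Orthonormal ℂ fun l : Fin (n + 1) => (b (Fin.castLE hfr l) : EuclideanSpace ℂ (Fin N)) := by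
    have h1 : Orthonormal ℂ fun l => (b l : EuclideanSpace ℂ (Fin N)) :=
      b.orthonormal.comp_linearIsometry Sᗮ.subtypeₗᵢ
    exact h1.comp _ (Fin.castLE_injective hfr)
  refine ⟨Matrix.of fun a l => (b (Fin.castLE hfr l) : EuclideanSpace ℂ (Fin N)) a, ?_, ?_⟩
  · ext l m
    have := orthonormal_iff_ite.1 hb l m
    rw [Matrix.mul_apply, Matrix.one_apply, ← this, PiLp.inner_apply]
    refine Finset.sum_congr rfl fun a _ => ?_
    simp [mul_comm]
  · ext l m
    have hm : (WithLp.toLp 2 fun a => A a m : EuclideanSpace ℂ (Fin N)) ∈ S :=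
      Submodule.subset_span ⟨m, rfl⟩
    have := Submodule.inner_left_of_mem_orthogonal hm (b (Fin.castLE hfr l)).2
    rw [Matrix.mul_apply, Matrix.zero_apply, ← this, PiLp.inner_apply]
    refine Finset.sum_congr rfl fun a _ => ?_
    simp [mul_comm]

variable {N n : ℕ} {β : Type*} [Fintype β] [DecidableEq β]

/-- The orthogonal projection of `h` on the orthogonal complement of the columns of `A`, when these
are linearly independent. -/
noncomputable def columnResidual (A : Matrix (Fin N) β ℂ) (h : Fin N → ℂ) : Fin N → ℂ :=
  (1 - A * (Aᴴ * A)⁻¹ * Aᴴ) *ᵥ h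

/-- The difference of the two sides is a self-adjoint idempotent, because the range of `U` is
orthogonal to the columns of `A`. Its trace is `N - card β - (n + 1) = 0`, so it vanishes. -/
lemma mul_conjTranspose_eq_of_orthonormal (A : Matrix (Fin N) β ℂ)
    (hA : Function.Injective A.mulVec) (hcard : Fintype.card β + (n + 1) = N)
    (U : Matrix (Fin N) (Fin (n + 1)) ℂ) (hU : Uᴴ * U = 1) (hUA : Uᴴ * A = 0) :
    U * Uᴴ = 1 - A * (Aᴴ * A)⁻¹ * Aᴴ := by
  have hdet : IsUnit (Aᴴ * A).det :=
    isUnit_iff_ne_zero.2 (Matrix.PosDef.conjTranspose_mul_self A hA).det_pos.ne'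
  have hAU : Aᴴ * U = 0 := by
    have := congrArg Matrix.conjTranspose hUA
    simpa using this
  set R : Matrix (Fin N) (Fin N) ℂ := A * (Aᴴ * A)⁻¹ * Aᴴ with hR
  have hRR : R * R = R := by
    rw [hR]
    calc A * (Aᴴ * A)⁻¹ * Aᴴ * (A * (Aᴴ * A)⁻¹ * Aᴴ)
        = A * ((Aᴴ * A)⁻¹ * (Aᴴ * A)) * (Aᴴ * A)⁻¹ * Aᴴ := by simp only [Matrix.mul_assoc]
      _ = _ := by rw [Matrix.nonsing_inv_mul _ hdet, Matrix.mul_one]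
  have hRH : Rᴴ = R := by
    rw [hR, Matrix.conjTranspose_mul, Matrix.conjTranspose_mul, Matrix.conjTranspose_nonsing_inv,
      Matrix.conjTranspose_mul, Matrix.conjTranspose_conjTranspose, Matrix.mul_assoc]
  have hRU : R * (U * Uᴴ) = 0 := by
    rw [hR, ← Matrix.mul_assoc, Matrix.mul_assoc _ Aᴴ U, hAU]
    simp
  have hUR : U * Uᴴ * R = 0 := by
    rw [hR, Matrix.mul_assoc U, ← Matrix.mul_assoc Uᴴ, ← Matrix.mul_assoc Uᴴ, hUA]
    simp
  have hUU : U * Uᴴ * (U * Uᴴ) = U * Uᴴ := by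
    rw [Matrix.mul_assoc U, ← Matrix.mul_assoc Uᴴ, hU, Matrix.one_mul]
  have htr : (1 - R - U * Uᴴ).trace = 0 := by
    rw [Matrix.trace_sub, Matrix.trace_sub, Matrix.trace_mul_comm U, hU, hR,
      Matrix.trace_mul_comm, ← Matrix.mul_assoc, Matrix.mul_nonsing_inv _ hdet]
    simp only [Matrix.trace_one, Fintype.card_fin]
    rw [← hcard]
    push_cast
    ring
  have hsq : (1 - R - U * Uᴴ)ᴴ * (1 - R - U * Uᴴ) = 1 - R - U * Uᴴ := by
    rw [Matrix.conjTranspose_sub, Matrix.conjTranspose_sub, hRH, Matrix.conjTranspose_one,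
      Matrix.conjTranspose_mul, Matrix.conjTranspose_conjTranspose]
    simp only [Matrix.mul_sub, Matrix.sub_mul, Matrix.one_mul, Matrix.mul_one, hRR, hRU, hUR, hUU]
    abel
  have hz : 1 - R - U * Uᴴ = 0 := by
    rw [← Matrix.trace_conjTranspose_mul_self_eq_zero_iff, hsq, htr]
  exact (sub_eq_zero.1 hz).symm

lemma vecNorm_sq {m : ℕ} (w : Fin m → ℂ) : ((vecNorm w ^ 2 : ℝ) : ℂ) = star w ⬝ᵥ w := by
  rw [vecNorm, EuclideanSpace.norm_sq_eq, dotProduct]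
  push_cast
  refine Finset.sum_congr rfl fun a _ => ?_
  rw [Pi.star_apply, ← Complex.conj_mul']
  rfl

lemma vecNorm_mulVec_of_orthonormal {l m : ℕ} (U : Matrix (Fin m) (Fin l) ℂ) (hU : Uᴴ * U = 1)
    (w : Fin l → ℂ) : vecNorm (U *ᵥ w) = vecNorm w := by
  have h : vecNorm (U *ᵥ w) ^ 2 = vecNorm w ^ 2 := by
    have : ((vecNorm (U *ᵥ w) ^ 2 : ℝ) : ℂ) = ((vecNorm w ^ 2 : ℝ) : ℂ) := by
      rw [vecNorm_sq, vecNorm_sq, Matrix.star_mulVec, Matrix.dotProduct_mulVec,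
        Matrix.vecMul_vecMul, hU, Matrix.vecMul_one]
    exact_mod_cast this
  exact (sq_eq_sq₀ (norm_nonneg _) (norm_nonneg _)).1 h

lemma vecNorm_columnResidual (A : Matrix (Fin N) β ℂ)
    (hA : Function.Injective A.mulVec) (hcard : Fintype.card β + (n + 1) = N)
    (U : Matrix (Fin N) (Fin (n + 1)) ℂ) (hU : Uᴴ * U = 1) (hUA : Uᴴ * A = 0) (h : Fin N → ℂ) :
    vecNorm (columnResidual A h) = vecNorm (Uᴴ *ᵥ h) := by
  rw [columnResidual, ← mul_conjTranspose_eq_of_orthonormal A hA hcard U hU hUA,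
    ← Matrix.mulVec_mulVec, vecNorm_mulVec_of_orthonormal U hU]

/-- Writing the inverse as adjugate over determinant expresses the residual through continuous
functions and one scalar inverse, which is measurable even where the determinant is zero. -/
lemma measurable_vecNorm_columnResidual :
    Measurable fun p : ((Fin N × β) × Bool → ℝ) × (Fin N × Bool → ℝ) =>
      vecNorm (columnResidual (complexMatrix p.1) (complexVector p.2)) ^ 2 := by
  have hA : Continuous fun p : ((Fin N × β) × Bool → ℝ) × (Fin N × Bool → ℝ) =>
      complexMatrix p.1 := by fun_prop
  have hG : Continuous fun p : ((Fin N × β) × Bool → ℝ) × (Fin N × Bool → ℝ) =>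
      (complexMatrix p.1)ᴴ * complexMatrix p.1 := hA.matrix_conjTranspose.matrix_mul hA
  have hR : ∀ p : ((Fin N × β) × Bool → ℝ) × (Fin N × Bool → ℝ),
      columnResidual (complexMatrix p.1) (complexVector p.2) = complexVector p.2 -
        ((complexMatrix p.1)ᴴ * complexMatrix p.1).det⁻¹ •
          (complexMatrix p.1 * ((complexMatrix p.1)ᴴ * complexMatrix p.1).adjugate *
            (complexMatrix p.1)ᴴ) *ᵥ complexVector p.2 := by
    intro p
    rw [columnResidual, Matrix.inv_def, Ring.inverse_eq_inv', Matrix.mul_smul, Matrix.smul_mul,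
      Matrix.sub_mulVec, Matrix.one_mulVec, Matrix.smul_mulVec]
  simp_rw [hR, vecNorm, EuclideanSpace.norm_sq_eq]
  refine Finset.measurable_sum _ fun a _ => Measurable.pow_const (Measurable.norm ?_) 2
  refine Measurable.sub ?_ (Measurable.mul (Measurable.inv ?_) ?_)
  · exact Continuous.measurable (by fun_prop)
  · exact hG.matrix_det.measurable
  · have hv : Continuous fun p : ((Fin N × β) × Bool → ℝ) × (Fin N × Bool → ℝ) =>
      complexVector p.2 := by fun_prop
    exact ((continuous_apply a).comp (((hA.matrix_mul hG.matrix_adjugate).matrix_mul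
      hA.matrix_conjTranspose).matrix_mulVec hv)).measurable

end NullSpace

/-! ### Ordered gamma samples and `varphi` -/

section OrderedGains

variable {Ω : Type*} [MeasurableSpace Ω] {μ : Measure Ω} {M N K : ℕ}
  {G : Fin K → Ω → ℝ} {σ : Ω → Equiv.Perm (Fin K)}

lemma ae_orderStatistic_nonneg
    (hG : ∀ j, HasLaw (G j) (gammaMeasure ((N - M + 1 : ℕ) : ℝ) 1) μ) :
    ∀ᵐ ω ∂μ, ∀ j, 0 ≤ G j ω :=
  ae_all_iff.2 fun j => ((hG j).ae_iff (measurableSet_setOfPred.1 measurableSet_Ici)).2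
    (ae_nonneg_gammaMeasure _)

lemma integrable_orderStatistic
    (hG : ∀ j, HasLaw (G j) (gammaMeasure ((N - M + 1 : ℕ) : ℝ) 1) μ)
    (hσ : ∀ᵐ ω ∂μ, Antitone fun r => G (σ ω r) ω) (r : Fin K) :
    Integrable (fun ω => G (σ ω r) ω) μ := by
  have hi : ∀ j, Integrable (G j) μ := fun j => by
    have h := integrable_id_gammaMeasure (N - M)
    rw [← (hG j).map_eq] at h
    exact h.comp_aemeasurable (hG j).aemeasurable
  refine (integrable_finsetSum Finset.univ fun j _ => hi j).mono'
    (aemeasurable_orderStatistic (fun j => (hG j).aemeasurable) hσ r).aestronglyMeasurable ?_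
  filter_upwards [ae_orderStatistic_nonneg hG] with ω hω
  rw [Real.norm_of_nonneg (hω _)]
  exact Finset.single_le_sum (f := fun j => G j ω) (fun j _ => hω j) (Finset.mem_univ (σ ω r))

lemma integrable_logb_orderStatistic
    (hG : ∀ j, HasLaw (G j) (gammaMeasure ((N - M + 1 : ℕ) : ℝ) 1) μ)
    (hσ : ∀ᵐ ω ∂μ, Antitone fun r => G (σ ω r) ω) (r : Fin K) {φ : ℝ} (hφ : 0 ≤ φ) :
    Integrable (fun ω => Real.logb 2 (1 + φ * G (σ ω r) ω)) μ := by
  refine (integrable_log_one_add_mul (Z := fun ω => G (σ ω r) ω) ?_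
    (integrable_orderStatistic hG hσ r) hφ).div_const _
  filter_upwards [ae_orderStatistic_nonneg hG] with ω hω using hω _

variable [IsProbabilityMeasure μ]

/-- The alternating sum is the distribution function of the ordered gain, so the bracket in the
integrand is its tail. The argument is `r + 1` since places are counted from `0`. -/
lemma varphiIntegrand_eq
    (hG : ∀ j, HasLaw (G j) (gammaMeasure ((N - M + 1 : ℕ) : ℝ) 1) μ) (hind : iIndepFun G μ)
    (hσ : ∀ᵐ ω ∂μ, Antitone fun r => G (σ ω r) ω) (r : Fin K) (φ : ℝ) {x : ℝ} (hx : 0 ≤ x) :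
    varphiIntegrand M N K (r + 1) φ x = 1 / (1 + x * φ) * μ.real {ω | x < G (σ ω r) ω} := by
  have hF : ∀ j, μ.real {ω | G j ω ≤ x} =
      lowerGamma ((N - M + 1 : ℕ) : ℝ) x / (N - M).factorial := fun j => by
    rw [← measureReal_gammaMeasure_le _ hx]
    exact (hG j).measureReal_eq measurableSet_Iic
  have hm : NullMeasurableSet {ω | G (σ ω r) ω ≤ x} μ :=
    (aemeasurable_orderStatistic (fun j => (hG j).aemeasurable) hσ r).nullMeasurable
      measurableSet_Iic
  have hle := measureReal_orderStatistic_le (fun j => (hG j).aemeasurable) hind hF hσ r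
  rw [sum_choose_mul_pow_eq K r r.2] at hle
  have hc : {ω | x < G (σ ω r) ω} = {ω | G (σ ω r) ω ≤ x}ᶜ := by
    ext ω
    simp
  rw [hc, measureReal_compl₀ hm, probReal_univ, hle,
    varphiIntegrand]
  simp

lemma integrableOn_varphiIntegrand_of_hasLaw
    (hG : ∀ j, HasLaw (G j) (gammaMeasure ((N - M + 1 : ℕ) : ℝ) 1) μ) (hind : iIndepFun G μ)
    (hσ : ∀ᵐ ω ∂μ, Antitone fun r => G (σ ω r) ω) (r : Fin K) {φ : ℝ} (hφ : 0 ≤ φ) :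
    IntegrableOn (varphiIntegrand M N K (r + 1) φ) (Set.Ioi 0) := by
  refine IntegrableOn.congr_fun (integrableOn_tail_div (Z := fun ω => G (σ ω r) ω) ?_
    (integrable_orderStatistic hG hσ r) hφ)
    (fun x hx => (varphiIntegrand_eq hG hind hσ r φ (le_of_lt hx)).symm) measurableSet_Ioi
  filter_upwards [ae_orderStatistic_nonneg hG] with ω hω using hω _

lemma integral_logb_orderStatistic
    (hG : ∀ j, HasLaw (G j) (gammaMeasure ((N - M + 1 : ℕ) : ℝ) 1) μ) (hind : iIndepFun G μ)
    (hσ : ∀ᵐ ω ∂μ, Antitone fun r => G (σ ω r) ω) (r : Fin K) {φ : ℝ} (hφ : 0 ≤ φ) :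
    ∫ ω, Real.logb 2 (1 + φ * G (σ ω r) ω) ∂μ = varphi M N K (r + 1) φ := by
  have h0 : 0 ≤ᵐ[μ] fun ω => G (σ ω r) ω := by
    filter_upwards [ae_orderStatistic_nonneg hG] with ω hω using hω _
  simp only [Real.logb]
  rw [integral_div, integral_log_one_add_mul h0 (integrable_orderStatistic hG hσ r) hφ, varphi,
    setIntegral_congr_fun measurableSet_Ioi
      fun x hx => (varphiIntegrand_eq hG hind hσ r φ (le_of_lt hx)).symm]
  ring

end OrderedGains

/-- The claim involves no randomness, so a model sample is supplied: the coordinates of a product of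
gamma laws, sorted decreasingly. -/
lemma integrableOn_varphiIntegrand (M N K : ℕ) (r : Fin K) {φ : ℝ} (hφ : 0 ≤ φ) :
    IntegrableOn (varphiIntegrand M N K (r + 1) φ) (Set.Ioi 0) := by
  have : IsProbabilityMeasure (gammaMeasure ((N - M + 1 : ℕ) : ℝ) 1) :=
    isProbabilityMeasure_gammaMeasure (by positivity) one_pos
  refine integrableOn_varphiIntegrand_of_hasLaw
    (μ := Measure.pi fun _ : Fin K => gammaMeasure ((N - M + 1 : ℕ) : ℝ) 1)
    (G := fun j y => y j) (σ := fun y => Tuple.sort fun j => -y j)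
    (fun j => (measurePreserving_eval
      (fun _ : Fin K => gammaMeasure ((N - M + 1 : ℕ) : ℝ) 1) j).hasLaw)
    (iIndepFun_pi (X := fun _ x => x) fun _ => aemeasurable_id) ?_ r hφ
  refine Filter.Eventually.of_forall fun y a b hab => ?_
  have := Tuple.monotone_sort (fun j => -y j) hab
  simpa using this

/-! ### Law of the gain of one user -/

section Channel

variable {Ω : Type*} [MeasurableSpace Ω] {μ : Measure Ω} [IsProbabilityMeasure μ]

lemma iIndepFun_curry {J S : Type*} [Fintype J] [Fintype S] {X : J × S → Ω → ℝ}
    (hX : ∀ q, AEMeasurable (X q) μ) (hind : iIndepFun X μ) :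
    iIndepFun (fun j ω s => X (j, s) ω) μ := by
  have hp : ∀ q, IsProbabilityMeasure (μ.map (X q)) := fun q =>
    Measure.isProbabilityMeasure_map (hX q)
  have hm : ∀ j, AEMeasurable (fun ω s => X (j, s) ω) μ := fun j =>
    aemeasurable_pi_lambda _ fun s => hX (j, s)
  have hblock : ∀ j, μ.map (fun ω s => X (j, s) ω) = Measure.pi fun s => μ.map (X (j, s)) :=
    fun j => (hind.precomp (Prod.mk_right_injective j)).map_fun_eq_pi_map fun s => hX (j, s)
  rw [iIndepFun_iff_map_fun_eq_pi_map hm]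
  simp_rw [hblock]
  have h1 := Measure.infinitePi_map_curry fun j s => μ.map (X (j, s))
  simp_rw [Measure.infinitePi_eq_pi] at h1
  rw [← h1, ← hind.map_fun_eq_pi_map hX, AEMeasurable.map_map_of_aemeasurable
    (MeasurableEquiv.measurable _).aemeasurable (aemeasurable_pi_lambda _ hX)]
  rfl

/-- By independence the joint law is a product. Fubini then averages over `x` a conditional law that
is almost surely the constant `ν`. -/
lemma hasLaw_of_indepFun_of_ae_hasLaw {E F : Type*} [MeasurableSpace E] [MeasurableSpace F]
    {X : Ω → E} {Y : Ω → F} (hX : AEMeasurable X μ) (hY : AEMeasurable Y μ) (hXY : IndepFun X Y μ)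
    {q : E × F → ℝ} (hq : Measurable q) {ν : Measure ℝ}
    (h : ∀ᵐ x ∂μ.map X, HasLaw (fun ω => q (x, Y ω)) ν μ) :
    HasLaw (fun ω => q (X ω, Y ω)) ν μ := by
  have := Measure.isProbabilityMeasure_map hX
  have := Measure.isProbabilityMeasure_map hY
  refine ⟨hq.comp_aemeasurable (hX.prodMk hY), ?_⟩
  have hcomp := AEMeasurable.map_map_of_aemeasurable hq.aemeasurable (hX.prodMk hY)
  rw [(indepFun_iff_map_prod_eq_prod_map_map hX hY).1 hXY] at hcomp
  refine hcomp.symm.trans (Measure.ext fun S hS => ?_)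
  rw [Measure.map_apply hq hS, Measure.prod_apply (hq hS)]
  have hconst : ∀ᵐ x ∂μ.map X, (μ.map Y) (Prod.mk x ⁻¹' (q ⁻¹' S)) = ν S := by
    filter_upwards [h] with x hx
    rw [← hx.map_eq, Measure.map_apply_of_aemeasurable hx.aemeasurable hS,
      Measure.map_apply_of_aemeasurable hY (measurable_prodMk_left (hq hS))]
    rfl
  rw [lintegral_congr_ae hconst]
  simp

lemma hasLaw_vecNorm_columnResidual {N n : ℕ} {β : Type*} [Fintype β] [DecidableEq β]
    (hcard : Fintype.card β + (n + 1) = N)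
    {X : Ω → (Fin N × β) × Bool → ℝ} {Y : Fin N × Bool → Ω → ℝ}
    (hX : HasLaw X (Measure.pi fun _ => gaussianReal 0 (1 / 2 : ℝ≥0)) μ)
    (hY : ∀ q, HasLaw (Y q) (gaussianReal 0 (1 / 2 : ℝ≥0)) μ) (hind : iIndepFun Y μ)
    (hXY : IndepFun X (fun ω q => Y q ω) μ) :
    HasLaw (fun ω => vecNorm (columnResidual (complexMatrix (X ω))
      (complexVector fun q => Y q ω)) ^ 2) (gammaMeasure ((n + 1 : ℕ) : ℝ) 1) μ := by
  refine hasLaw_of_indepFun_of_ae_hasLaw hX.aemeasurable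
    (aemeasurable_pi_lambda _ fun q => (hY q).aemeasurable) hXY
    measurable_vecNorm_columnResidual ?_
  rw [hX.map_eq]
  have hβ : Fintype.card β ≤ N := by omega
  filter_upwards [ae_injective_mulVec hβ] with x hx
  -- The basis is chosen for the frozen `x` alone. No measurable choice is needed, as the residual
  -- does not mention `U`.
  obtain ⟨U, hU, hUA⟩ := exists_orthonormal_conjTranspose_mul_eq_zero (complexMatrix x) hcard
  simp only [vecNorm_columnResidual _ hx hcard U hU hUA]
  exact hasLaw_norm_sq_conjTranspose_mulVec hY hind U hU

/-- The effective channel gain of a user as a function of the real and imaginary parts of the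
entries of the channel matrix, for the `i`-th column carrying the signal. -/
noncomputable def nullSpaceGain {M N : ℕ} (i : Fin M) (x : (Fin N × Fin M) × Bool → ℝ) : ℝ :=
  vecNorm (columnResidual
    (complexMatrix fun q : (Fin N × {m : Fin M // m ≠ i}) × Bool => x ((q.1.1, q.1.2), q.2))
    (complexVector fun q => x ((q.1, i), q.2))) ^ 2

lemma measurable_nullSpaceGain {M N : ℕ} (i : Fin M) :
    Measurable (nullSpaceGain (N := N) i) := by
  have hA : Measurable fun (x : (Fin N × Fin M) × Bool → ℝ)
      (q : (Fin N × {m : Fin M // m ≠ i}) × Bool) => x ((q.1.1, q.1.2), q.2) :=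
    measurable_pi_lambda _ fun _ => measurable_pi_apply _
  have hh : Measurable fun (x : (Fin N × Fin M) × Bool → ℝ) (q : Fin N × Bool) =>
      x ((q.1, i), q.2) :=
    measurable_pi_lambda _ fun _ => measurable_pi_apply _
  have h := measurable_vecNorm_columnResidual.comp (hA.prodMk hh)
  unfold nullSpaceGain
  simp only [Function.comp_def] at h
  exact h

lemma card_ne_add {M N : ℕ} (hMN : M ≤ N) (i : Fin M) :
    Fintype.card {m : Fin M // m ≠ i} + (N - M + 1) = N := by
  rw [Fintype.card_subtype_compl, Fintype.card_fin, Fintype.card_subtype_eq]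
  have := i.pos
  omega

lemma hasLaw_nullSpaceGain {M N : ℕ} (hMN : M ≤ N) (i : Fin M)
    {Z : (Fin N × Fin M) × Bool → Ω → ℝ}
    (hZ : ∀ q, HasLaw (Z q) (gaussianReal 0 (1 / 2 : ℝ≥0)) μ) (hind : iIndepFun Z μ) :
    HasLaw (fun ω => nullSpaceGain i fun q => Z q ω)
      (gammaMeasure ((N - M + 1 : ℕ) : ℝ) 1) μ := by
  classical
  have hX : iIndepFun (fun (q : (Fin N × {m : Fin M // m ≠ i}) × Bool) =>
      Z ((q.1.1, q.1.2), q.2)) μ := by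
    refine hind.precomp (g := fun q : (Fin N × {m : Fin M // m ≠ i}) × Bool =>
      ((q.1.1, (q.1.2 : Fin M)), q.2)) ?_
    rintro ⟨⟨a, b⟩, s⟩ ⟨⟨a', b'⟩, s'⟩ h
    simpa [Subtype.ext_iff] using h
  have hY : iIndepFun (fun (q : Fin N × Bool) => Z ((q.1, i), q.2)) μ := by
    refine hind.precomp (g := fun q : Fin N × Bool => ((q.1, i), q.2)) ?_
    rintro ⟨a, s⟩ ⟨a', s'⟩ h
    simpa using h
  refine hasLaw_vecNorm_columnResidual (card_ne_add hMN i)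
    (X := fun ω q => Z ((q.1.1, q.1.2), q.2) ω) (Y := fun q => Z ((q.1, i), q.2)) ?_
    (fun q => hZ _) hY ?_
  · refine ⟨aemeasurable_pi_lambda _ fun q => (hZ _).aemeasurable, ?_⟩
    rw [hX.map_fun_eq_pi_map fun q => (hZ _).aemeasurable]
    congr 1
    exact funext fun q => (hZ _).map_eq
  -- The interfering columns and the signal column use disjoint sets of coordinates, hence are
  -- independent.
  · set S : Finset ((Fin N × Fin M) × Bool) := Finset.univ.filter fun q => q.1.2 ≠ i with hS
    set T : Finset ((Fin N × Fin M) × Bool) := Finset.univ.filter fun q => q.1.2 = i with hT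
    have hST : Disjoint S T := Finset.disjoint_left.2 fun q h h' => by
      rw [hS, Finset.mem_filter] at h
      rw [hT, Finset.mem_filter] at h'
      exact h.2 h'.2
    have h := hind.indepFun_finset₀ S T hST fun q => (hZ q).aemeasurable
    exact h.comp
      (φ := fun (z : S → ℝ) (q : (Fin N × {m : Fin M // m ≠ i}) × Bool) =>
        z ⟨((q.1.1, q.1.2), q.2), by simp [hS, q.1.2.2]⟩)
      (ψ := fun (z : T → ℝ) (q : Fin N × Bool) => z ⟨((q.1, i), q.2), by simp [hT]⟩)
      (by fun_prop) (by fun_prop)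

end Channel

/-! ### Detection vectors and rates for a fixed channel -/

section Detection

lemma vecNorm_real_smul {m : ℕ} (c : ℝ) (w : Fin m → ℂ) :
    vecNorm (c • w) = |c| * vecNorm w := by
  rw [vecNorm, WithLp.toLp_smul, norm_smul, Real.norm_eq_abs, vecNorm]

/-- With `w = Uᴴ h` the inner product is `|w|⁻¹ |w|²`. The convention `0⁻¹ = 0` makes this correct
for `w = 0` too. -/
lemma norm_detectionVector_dotProduct {N L : ℕ} (U : Matrix (Fin N) (Fin L) ℂ) (h : Fin N → ℂ) :
    ‖star (detectionVector U h) ⬝ᵥ h‖ = vecNorm (Uᴴ *ᵥ h) := by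
  have h1 : star (detectionVector U h) ⬝ᵥ h =
      (((vecNorm (Uᴴ *ᵥ h))⁻¹ * vecNorm (Uᴴ *ᵥ h) ^ 2 : ℝ) : ℂ) := by
    rw [Complex.ofReal_mul, vecNorm_sq, detectionVector, Matrix.star_mulVec,
      ← Matrix.dotProduct_mulVec, star_smul, smul_dotProduct, Complex.real_smul]
    simp
  have h0 : 0 ≤ vecNorm (Uᴴ *ᵥ h) := norm_nonneg _
  rw [h1, Complex.norm_real, Real.norm_of_nonneg (by positivity)]
  rcases h0.eq_or_lt with h2 | h2
  · simp [← h2]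
  · field_simp

lemma vecNorm_detectionVector {N L : ℕ} (U : Matrix (Fin N) (Fin L) ℂ) (hU : Uᴴ * U = 1)
    (h : Fin N → ℂ) (h0 : vecNorm (Uᴴ *ᵥ h) ≠ 0) : vecNorm (detectionVector U h) = 1 := by
  rw [detectionVector, vecNorm_mulVec_of_orthonormal U hU, vecNorm_real_smul, abs_inv,
    abs_of_nonneg (show 0 ≤ vecNorm (Uᴴ *ᵥ h) from norm_nonneg _), inv_mul_cancel₀ h0]

variable {M N K : ℕ} {H : Fin M → Fin K → Matrix (Fin N) (Fin M) ℂ}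
  {U : Fin M → Fin K → Matrix (Fin N) (Fin (N - M + 1)) ℂ}

lemma effGain_nonneg (i : Fin M) (j : Fin K) : 0 ≤ effGain H U i j := sq_nonneg _

lemma vecNorm_userDetector_of_effGain_ne_zero {i : Fin M} {j : Fin K}
    (hU : IsNullSpaceBasis (H i j) i (U i j)) (h0 : effGain H U i j ≠ 0) :
    vecNorm (userDetector H U i j) = 1 := by
  refine vecNorm_detectionVector _ hU.1 _ fun h => h0 ?_
  rw [effGain, userDetector, norm_detectionVector_dotProduct, h]
  simp

lemma effGain_eq_nullSpaceGain (hMN : M ≤ N) {i : Fin M} {j : Fin K}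
    (hU : IsNullSpaceBasis (H i j) i (U i j))
    (hinj : Function.Injective ((H i j).submatrix id (Subtype.val : {m : Fin M // m ≠ i} → Fin M)).mulVec) :
    effGain H U i j = nullSpaceGain i fun q =>
      if q.2 then (H i j q.1.1 q.1.2).re else (H i j q.1.1 q.1.2).im := by
  have hA : (complexMatrix fun q : (Fin N × {m : Fin M // m ≠ i}) × Bool =>
      if q.2 then (H i j q.1.1 q.1.2).re else (H i j q.1.1 q.1.2).im) =
      (H i j).submatrix id (Subtype.val : {m : Fin M // m ≠ i} → Fin M) := by
    ext a b
    simp [complexMatrix, Complex.re_add_im]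
  have hh : (complexVector fun q : Fin N × Bool =>
      if q.2 then (H i j q.1 i).re else (H i j q.1 i).im) = (H i j).col i := by
    ext a
    simp [complexVector, Complex.re_add_im]
  have hUA : (U i j)ᴴ * (H i j).submatrix id (Subtype.val : {m : Fin M // m ≠ i} → Fin M) = 0 := by
    ext l m
    exact congrFun (hU.2 m m.2) l
  rw [nullSpaceGain, hA, hh, vecNorm_columnResidual _ hinj (card_ne_add hMN i) (U i j) hU.1 hUA,
    effGain, userDetector, norm_detectionVector_dotProduct]

lemma logb_one_add_snrWeak {ρ αn αk : ℝ} (hρ : 0 < ρ) (hα : αn ^ 2 + αk ^ 2 = 1) {i : Fin M}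
    {j : Fin K} (hU : IsNullSpaceBasis (H i j) i (U i j)) :
    Real.logb 2 (1 + snrWeak H U ρ αn αk i j) =
      Real.logb 2 (1 + ρ * effGain H U i j) - Real.logb 2 (1 + ρ * αn ^ 2 * effGain H U i j) := by
  -- For zero gain the detection vector need not be a unit vector, but every logarithm is `log 1`.
  by_cases h0 : effGain H U i j = 0
  · simp [snrWeak, h0]
  have hg := effGain_nonneg (H := H) (U := U) i j
  rw [snrWeak, vecNorm_userDetector_of_effGain_ne_zero hU h0]
  set g := effGain H U i j
  have h1 : 0 < 1 + ρ * g := by positivity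
  have h2 : 0 < 1 + ρ * αn ^ 2 * g := by positivity
  rw [← Real.logb_div h1.ne' h2.ne']
  have h3 : 0 < g * αn ^ 2 + 1 ^ 2 * (1 / ρ) := by positivity
  congr 1
  rw [eq_div_iff h2.ne', eq_sub_iff_add_eq'.2 hα]
  field_simp
  ring

lemma snrStrong_eq {ρ αn : ℝ} {i : Fin M} {j : Fin K}
    (hU : IsNullSpaceBasis (H i j) i (U i j)) :
    snrStrong H U ρ αn i j = ρ * αn ^ 2 * effGain H U i j := by
  by_cases h0 : effGain H U i j = 0
  · simp [snrStrong, h0]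
  rw [snrStrong, vecNorm_userDetector_of_effGain_ne_zero hU h0]
  ring

end Detection

/-! ### Gains under Rayleigh fading -/

section Fading

variable {Ω : Type*} [MeasurableSpace Ω] {μ : Measure Ω} {M N K : ℕ}
  {H : Ω → Fin M → Fin K → Matrix (Fin N) (Fin M) ℂ}

/-- The real and imaginary parts of the entries of the channel matrix of a user. -/
noncomputable def channelParts (H : Ω → Fin M → Fin K → Matrix (Fin N) (Fin M) ℂ) (i : Fin M)
    (j : Fin K) (q : (Fin N × Fin M) × Bool) (ω : Ω) : ℝ :=
  if q.2 then (H ω i j q.1.1 q.1.2).re else (H ω i j q.1.1 q.1.2).im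

lemma IsRayleighFading.hasLaw_channelParts (hH : IsRayleighFading μ H) (i : Fin M) (j : Fin K)
    (q : (Fin N × Fin M) × Bool) :
    HasLaw (channelParts H i j q) (gaussianReal 0 (1 / 2 : ℝ≥0)) μ := by
  rcases q with ⟨⟨a, b⟩, _ | _⟩
  · exact hH.2.1 i j a b
  · exact hH.1 i j a b

lemma IsRayleighFading.iIndepFun_channelParts_uncurry (hH : IsRayleighFading μ H) (i : Fin M) :
    iIndepFun (fun q : Fin K × (Fin N × Fin M) × Bool => channelParts H i q.1 q.2) μ := by
  have h := hH.2.2.precomp (g := fun q : Fin K × (Fin N × Fin M) × Bool =>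
    ((i, q.1, q.2.1.1, q.2.1.2), q.2.2)) (by
      rintro ⟨j, ⟨a, b⟩, s⟩ ⟨j', ⟨a', b'⟩, s'⟩ h
      simp only [Prod.mk.injEq, true_and] at h ⊢
      tauto)
  exact h

lemma IsRayleighFading.ae_injective_mulVec (hH : IsRayleighFading μ H) (hMN : M ≤ N) (i : Fin M)
    (j : Fin K) :
    ∀ᵐ ω ∂μ, Function.Injective
      ((H ω i j).submatrix id (Subtype.val : {m : Fin M // m ≠ i} → Fin M)).mulVec := by
  set X : Ω → (Fin N × {m : Fin M // m ≠ i}) × Bool → ℝ := fun ω q =>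
    channelParts H i j ((q.1.1, q.1.2), q.2) ω with hX
  have hXm : AEMeasurable X μ :=
    aemeasurable_pi_lambda _ fun q => (hH.hasLaw_channelParts i j _).aemeasurable
  have hind : iIndepFun (fun (q : (Fin N × {m : Fin M // m ≠ i}) × Bool) =>
      channelParts H i j ((q.1.1, q.1.2), q.2)) μ := by
    refine (hH.iIndepFun_channelParts_uncurry i).precomp
      (g := fun q : (Fin N × {m : Fin M // m ≠ i}) × Bool =>
        (j, (q.1.1, (q.1.2 : Fin M)), q.2)) ?_
    rintro ⟨⟨a, b⟩, s⟩ ⟨⟨a', b'⟩, s'⟩ h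
    simpa [Subtype.ext_iff] using h
  have hmap : μ.map X = Measure.pi fun _ => gaussianReal 0 (1 / 2 : ℝ≥0) := by
    rw [hX, hind.map_fun_eq_pi_map fun q => (hH.hasLaw_channelParts i j _).aemeasurable]
    congr 1
    exact funext fun q => (hH.hasLaw_channelParts i j _).map_eq
  have hcard := card_ne_add hMN i
  have h := MimoNoma.ae_injective_mulVec (N := N) (β := {m : Fin M // m ≠ i}) (by omega)
  rw [← hmap] at h
  filter_upwards [ae_of_ae_map hXm h] with ω hω
  convert hω using 2
  ext a b
  simp [hX, complexMatrix, channelParts, Complex.re_add_im]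

variable [IsProbabilityMeasure μ]

lemma IsRayleighFading.hasLaw_nullSpaceGain (hH : IsRayleighFading μ H) (hMN : M ≤ N) (i : Fin M)
    (j : Fin K) :
    HasLaw (fun ω => nullSpaceGain i fun q => channelParts H i j q ω)
      (gammaMeasure ((N - M + 1 : ℕ) : ℝ) 1) μ :=
  MimoNoma.hasLaw_nullSpaceGain hMN i (hH.hasLaw_channelParts i j)
    ((hH.iIndepFun_channelParts_uncurry i).precomp
      (g := fun q : (Fin N × Fin M) × Bool => (j, q)) (Prod.mk_right_injective j))

lemma IsRayleighFading.iIndepFun_nullSpaceGain (hH : IsRayleighFading μ H) (i : Fin M) :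
    iIndepFun (fun (j : Fin K) ω => nullSpaceGain i fun q => channelParts H i j q ω) μ :=
  (iIndepFun_curry (fun q => (hH.hasLaw_channelParts i q.1 q.2).aemeasurable)
    (hH.iIndepFun_channelParts_uncurry i)).comp (fun _ => nullSpaceGain i)
    fun _ => measurable_nullSpaceGain i

end Fading

end MimoNoma

/-- The places in the ordering are counted from `0`, so that `n : Fin K` stands for the
`(n + 1)`-st ordered user. -/
theorem lemma1 {Ω : Type*} [MeasurableSpace Ω] (μ : Measure Ω) [IsProbabilityMeasure μ]
    (M N K : ℕ) (hMN : M ≤ N)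
    (H : Ω → Fin M → Fin K → Matrix (Fin N) (Fin M) ℂ)
    (hH : MimoNoma.IsRayleighFading μ H)
    (U : Ω → Fin M → Fin K → Matrix (Fin N) (Fin (N - M + 1)) ℂ)
    (hU : ∀ᵐ ω ∂μ, ∀ i j, MimoNoma.IsNullSpaceBasis (H ω i j) i (U ω i j))
    (σ : Ω → Fin M → Equiv.Perm (Fin K))
    (hσ : ∀ᵐ ω ∂μ, MimoNoma.IsGainOrdering (H ω) (U ω) (σ ω))
    (n k : Fin K) (hnk : n < k)
    (ρ αn αk : ℝ) (hρ : 0 < ρ) (hα : αn ^ 2 + αk ^ 2 = 1) :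
    (∀ (r : Fin K) (ϕ : ℝ), 0 ≤ ϕ →
      IntegrableOn (MimoNoma.varphiIntegrand M N K (r + 1) ϕ) (Set.Ioi 0)) ∧
    Integrable (fun ω => MimoNoma.sumRateGap (H ω) (U ω) (σ ω) ρ αn αk n k) μ ∧
    ∫ ω, MimoNoma.sumRateGap (H ω) (U ω) (σ ω) ρ αn αk n k ∂μ =
      (M : ℝ) / 2 * MimoNoma.varphi M N K (k + 1) ρ +
        M * MimoNoma.varphi M N K (n + 1) (ρ * αn ^ 2) -
        M * MimoNoma.varphi M N K (k + 1) (ρ * αn ^ 2) -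
        (M : ℝ) / 2 * MimoNoma.varphi M N K (n + 1) ρ := by
  refine ⟨fun r ϕ hϕ => MimoNoma.integrableOn_varphiIntegrand M N K r hϕ, ?_⟩
  set G : Fin M → Fin K → Ω → ℝ := fun i j ω =>
    MimoNoma.nullSpaceGain i fun q => MimoNoma.channelParts H i j q ω
  have hG : ∀ i j, HasLaw (G i j) (gammaMeasure ((N - M + 1 : ℕ) : ℝ) 1) μ :=
    fun i j => hH.hasLaw_nullSpaceGain hMN i j
  have hind : ∀ i, iIndepFun (G i) μ := fun i => hH.iIndepFun_nullSpaceGain i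
  -- From here on the arbitrary, possibly non-measurable choice of `U` is replaced by a measurable
  -- function of the channel.
  have hgain : ∀ᵐ ω ∂μ, ∀ i j, MimoNoma.effGain (H ω) (U ω) i j = G i j ω := by
    have hinj := ae_all_iff.2 fun i => ae_all_iff.2 fun j => hH.ae_injective_mulVec hMN i j
    filter_upwards [hU, hinj] with ω hω hω' i j
    exact MimoNoma.effGain_eq_nullSpaceGain hMN (hω i j) (hω' i j)
  have hord : ∀ i, ∀ᵐ ω ∂μ, Antitone fun r => G i (σ ω i r) ω := by
    intro i
    filter_upwards [hgain, hσ] with ω hω hω'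
    have := hω' i
    simp only [hω] at this
    exact this
  have hρα : 0 ≤ ρ * αn ^ 2 := by positivity
  -- The weak user's NOMA rate contains a full `log (1 + ρ g)`, of which the OMA rate cancels half.
  have hrw : (fun ω => MimoNoma.sumRateGap (H ω) (U ω) (σ ω) ρ αn αk n k) =ᵐ[μ] fun ω =>
      ∑ i : Fin M, (1 / 2 * Real.logb 2 (1 + ρ * G i (σ ω i k) ω) +
        Real.logb 2 (1 + ρ * αn ^ 2 * G i (σ ω i n) ω) -
        Real.logb 2 (1 + ρ * αn ^ 2 * G i (σ ω i k) ω) -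
        1 / 2 * Real.logb 2 (1 + ρ * G i (σ ω i n) ω)) := by
    filter_upwards [hgain, hU] with ω hω hω'
    rw [MimoNoma.sumRateGap, Finset.mul_sum, ← Finset.sum_sub_distrib]
    refine Finset.sum_congr rfl fun i _ => ?_
    rw [MimoNoma.logb_one_add_snrWeak hρ hα (hω' i _), MimoNoma.snrStrong_eq (hω' i _)]
    simp only [hω]
    ring
  have hlog : ∀ i r φ, 0 ≤ φ → Integrable (fun ω => Real.logb 2 (1 + φ * G i (σ ω i r) ω)) μ :=
    fun i r φ hφ => MimoNoma.integrable_logb_orderStatistic (hG i) (hord i) r hφ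
  have hint : ∀ i r φ, 0 ≤ φ → ∫ ω, Real.logb 2 (1 + φ * G i (σ ω i r) ω) ∂μ =
      MimoNoma.varphi M N K (r + 1) φ :=
    fun i r φ hφ => MimoNoma.integral_logb_orderStatistic (hG i) (hind i) (hord i) r hφ
  have i1 := fun i => (hlog i k ρ hρ.le).const_mul (1 / 2)
  have i2 := fun i => hlog i n _ hρα
  have i3 := fun i => hlog i k _ hρα
  have i4 := fun i => (hlog i n ρ hρ.le).const_mul (1 / 2)
  have i12 : ∀ i, Integrable (fun ω => 1 / 2 * Real.logb 2 (1 + ρ * G i (σ ω i k) ω) +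
      Real.logb 2 (1 + ρ * αn ^ 2 * G i (σ ω i n) ω)) μ := fun i => (i1 i).add (i2 i)
  have i123 : ∀ i, Integrable (fun ω => 1 / 2 * Real.logb 2 (1 + ρ * G i (σ ω i k) ω) +
      Real.logb 2 (1 + ρ * αn ^ 2 * G i (σ ω i n) ω) -
      Real.logb 2 (1 + ρ * αn ^ 2 * G i (σ ω i k) ω)) μ := fun i => (i12 i).sub (i3 i)
  have i5 : ∀ i, Integrable (fun ω => 1 / 2 * Real.logb 2 (1 + ρ * G i (σ ω i k) ω) +
      Real.logb 2 (1 + ρ * αn ^ 2 * G i (σ ω i n) ω) -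
      Real.logb 2 (1 + ρ * αn ^ 2 * G i (σ ω i k) ω) -
      1 / 2 * Real.logb 2 (1 + ρ * G i (σ ω i n) ω)) μ := fun i => (i123 i).sub (i4 i)
  refine ⟨(integrable_finsetSum _ fun i _ => i5 i).congr hrw.symm, ?_⟩
  rw [integral_congr_ae hrw, integral_finsetSum _ fun i _ => i5 i]
  have hterm : ∀ i, ∫ ω, (1 / 2 * Real.logb 2 (1 + ρ * G i (σ ω i k) ω) +
        Real.logb 2 (1 + ρ * αn ^ 2 * G i (σ ω i n) ω) -
        Real.logb 2 (1 + ρ * αn ^ 2 * G i (σ ω i k) ω) -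
        1 / 2 * Real.logb 2 (1 + ρ * G i (σ ω i n) ω)) ∂μ =
      1 / 2 * MimoNoma.varphi M N K (k + 1) ρ + MimoNoma.varphi M N K (n + 1) (ρ * αn ^ 2) -
        MimoNoma.varphi M N K (k + 1) (ρ * αn ^ 2) -
        1 / 2 * MimoNoma.varphi M N K (n + 1) ρ := by
    intro i
    rw [integral_sub (i123 i) (i4 i),
      integral_sub (i12 i) (i3 i), integral_add (i1 i) (i2 i), integral_const_mul,
      integral_const_mul, hint i k ρ hρ.le, hint i n ρ hρ.le, hint i k _ hρα, hint i n _ hρα]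
  rw [Finset.sum_congr rfl fun i _ => hterm i, Finset.sum_const, Finset.card_univ,
    Fintype.card_fin, nsmul_eq_mul]
  ring
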